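/- **Setting.** Let $(X,\epsilon,\eta)$ be a random element of $\mathbb R^p\times\mathbb R\times\mathbb R$ with law $P$, and suppose that for almost every $x$ the conditional law of $(\epsilon,\eta)$ given $X=x$ has support $\mathbb R^2$. Let $\Theta\subseteq\mathbb R$ with $|\Theta|\ge 2$, and let $\mathcal H$ be a non-empty set of measurable functions $\mathbb R^p\to\mathbb R^\ell$. Assume that every $\theta_0\in\Theta$ is joined inside $\Theta$ by a segment to all sufficiently close points of $\Theta$, and that every $h_0\in\mathcal H$ is joined inside $\mathcal H$ by a segment to all $h\in\mathcal H$ with $\mathbb E\|h(X)-h_0(X)\|^2$ sufficiently small (for instance, $\Theta$ and $\mathcal H$ convex). The possible true parameters are all pairs $(\theta_0,h_0)\in\Theta\times\mathcal H$. To each pair belong measurable functions $f_0=f_{\theta_0,h_0}$ and $g_0=g_{\theta_0,h_0}$ on $\mathbb R^p$ (for example, two components of $h_0$), and the data $Z=(T,Y,X)$ follow the partially linear regression model $$Y=\theta_0T+f_0(X)+\epsilon,\quad \mathbb E[\epsilon\mid X,T]=0,\qquad T=g_0(X)+\eta,\quad \mathbb E[\eta\mid X]=0\quad\text{a.s.},$$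 where the law $P$ of $(X,\epsilon,\eta)$ does not depend on $(\theta_0,h_0)$. Expectations under this model are denoted by $\mathbb E$. We observe independent copies $Z_1,\dots,Z_{2n}$ of $Z$. For a moment function $m:\mathbb R^{2+p}\times\mathbb R\times\mathbb R^\ell\to\mathbb R$, $(z,\theta,\gamma)\mapsto m(z,\theta,\gamma)$, let $\hat h\in\mathcal H$ be an estimate of $h_0$ computed from $Z_{n+1},\dots,Z_{2n}$, and let $\hat\theta_{SS}$ be a function of $Z_1,\dots,Z_{2n}$ which, with probability tending to $1$, lies in $\Theta$ and solves $\frac1n\sum_{t=1}^n m(Z_t,\theta,\hat h(X_t))=0$. For $\alpha\in\mathbb N^\ell$ put $\|\alpha\|_1=\sum_i\alpha_i$ and $D^\alpha m=\partial_{\gamma_1}^{\alpha_1}\cdots\partial_{\gamma_\ell}^{\alpha_\ell}m$. For functions $h$ write $h^{(c\alpha)}=\prod_{i}|h_i(X)-h_{0,i}(X)|^{c\alpha_i}$. **Claim.** There is no moment function $m$ such that for every $(\theta_0,h_0)\in\Theta\times\mathcal H$ there are a non-empty finite $S\subset\mathbb N^\ell$ and estimators $\hat h$, $\hat\theta_{SS}$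 as above for which all of the following hold, with $k=\max_{\alpha\in S}\|\alpha\|_1$. 1. The following conditions on $m$ and $\hat h$: * *Moment condition and $S$-orthogonality:* $\mathbb E[m(Z,\theta_0,h_0(X))\mid X]=0$ and $\mathbb E[D^\alpha m(Z,\theta_0,h_0(X))\mid X]=0$ a.s. for all $\alpha\in S$. * *Identifiability:* $\mathbb E[m(Z,\theta,h_0(X))]\ne0$ for all $\theta\in\Theta$, $\theta\neq\theta_0$. * *Smoothness:* $\nabla^k m$ exists and is continuous; the further derivatives used below exist (the $\gamma$-derivatives of $m$ up to order $k+1$, $\nabla_\theta m$, and $\nabla_\gamma\nabla_\theta m$), and $\nabla_\theta m$ is continuous. * *Consistency of the first stage:* $\mathbb E[\hat h^{(4\alpha)}\mid\hat h]\to0$ in probability for all $\alpha\in S\setminus\{0\}$. * *Rate of the first stage:* $\sqrt n\,\sqrt{\mathbb E[\hat h^{(2\alpha)}\mid\hat h]}\to0$ in probability for all $\alpha\notin S$ with $1\le\|\alpha\|_1\le k+1$. * *Regularity:* there is $r>0$ such that, with $B_{\theta_0}=\{\theta\in\Theta:|\theta-\theta_0|\le r\}$ and $B_{h_0}=\{h\in\mathcal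 H:\mathbb E[h^{(2\alpha)}]\le r\text{ whenever }1\le\|\alpha\|_1\le k+1\}$: (a) $\mathbb E[\sup_{\theta\in B_{\theta_0}}|\nabla_\theta m(Z,\theta,h_0(X))|]<\infty$; (b) $\sup_{h\in B_{h_0}}\mathbb E[\sup_{\theta\in B_{\theta_0}}\|\nabla_\gamma\nabla_\theta m(Z,\theta,h(X))\|^2]<\infty$; (c) $\max_{\|\alpha\|_1\le k+1}\sup_{h\in B_{h_0}}\mathbb E[|D^\alpha m(Z,\theta_0,h(X))|^4]<\infty$; (d) $\mathbb E[\sup_{\theta\in A,\,h\in B_{h_0}}|m(Z,\theta,h(X))|]<\infty$ for every compact $A\subseteq\Theta$; (e) $\sup_{\theta\in A,\,h\in B_{h_0}}\mathbb E[\|\nabla_\gamma m(Z,\theta,h(X))\|^2]<\infty$ for every compact $A\subseteq\Theta$. 2. $\mathbb E[\nabla_\theta m(Z,\theta_0,h_0(X))]=0$. 3. $\hat\theta_{SS}-\theta_0=O_P(1/\sqrt n)$. -/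

import Mathlib

open MeasureTheory ProbabilityTheory Filter Topology
open scoped ENNReal

/-- The space `ℝ^p` of covariates. -/
abbrev Cov (p : ℕ) : Type := EuclideanSpace ℝ (Fin p)

/-- The space `ℝ^ℓ` of values of the nuisance functions. -/
abbrev Nuis (ℓ : ℕ) : Type := EuclideanSpace ℝ (Fin ℓ)

/-- Data triplets `z = (t, y, x)`: treatment, outcome, covariates. -/
abbrev Data (p : ℕ) : Type := ℝ × ℝ × Cov p

/-- Moment functions `m(z, θ, γ)` for a real parameter `θ` and nuisance values `γ ∈ ℝ^ℓ`. -/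
abbrev Moment (p ℓ : ℕ) : Type := Data p → ℝ → Nuis ℓ → ℝ

noncomputable section

/-- `F` is integrable and `E[F | V] = 0` almost surely. -/
def CondMeanZero {Ω β : Type*} [MeasurableSpace Ω] [MeasurableSpace β]
    (μ : Measure Ω) (F : Ω → ℝ) (V : Ω → β) : Prop :=
  Integrable F μ ∧ μ[F | MeasurableSpace.comap V inferInstance] =ᵐ[μ] 0

/-! ### The partially linear regression model

The primitive is the joint law `P` of `(X, ε, η)`; it does not depend on `(θ₀, f₀, g₀)`. -/

/-- The conditions `E[ε | X, T] = 0` and `E[η | X] = 0` on the noise, where `T = g₀(X) + η`. -/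
structure IsPLR {p : ℕ} (P : Measure (Cov p × ℝ × ℝ)) (f₀ g₀ : Cov p → ℝ) : Prop where
  measurable_f : Measurable f₀
  measurable_g : Measurable g₀
  outcome_noise :
    CondMeanZero P (fun w => w.2.1) (fun w => (w.1, g₀ w.1 + w.2.2))
  treatment_noise : CondMeanZero P (fun w => w.2.2) (fun w => w.1)

/-- The observation `(T, Y, X)` generated from `w = (X, ε, η)` by
`T = g₀(X) + η` and `Y = θ₀ T + f₀(X) + ε`. -/
def plrData {p : ℕ} (θ₀ : ℝ) (f₀ g₀ : Cov p → ℝ) (w : Cov p × ℝ × ℝ) : Data p :=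
  (g₀ w.1 + w.2.2, θ₀ * (g₀ w.1 + w.2.2) + f₀ w.1 + w.2.1, w.1)

/-- The law of `Z = (T, Y, X)`. -/
def plrLaw {p : ℕ} (P : Measure (Cov p × ℝ × ℝ)) (θ₀ : ℝ) (f₀ g₀ : Cov p → ℝ) :
    Measure (Data p) :=
  P.map (plrData θ₀ f₀ g₀)

/-! ### Derivatives of the moment -/

/-- The partial derivative in the `i`-th coordinate. -/
def partialD {ℓ : ℕ} (i : Fin ℓ) (φ : Nuis ℓ → ℝ) : Nuis ℓ → ℝ :=
  fun γ => fderiv ℝ φ γ (EuclideanSpace.single i 1)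

/-- The iterated partial derivative `∂₁^{α₁} ∂₂^{α₂} ⋯ ∂_ℓ^{α_ℓ} φ`. -/
def multiD {ℓ : ℕ} (α : Fin ℓ → ℕ) (φ : Nuis ℓ → ℝ) : Nuis ℓ → ℝ :=
  (List.finRange ℓ).foldr (fun i ψ => (partialD i)^[α i] ψ) φ

/-- The derivative `∇_θ m(z, θ, γ)`. -/
def gradTheta {p ℓ : ℕ} (m : Moment p ℓ) (z : Data p) (θ : ℝ) (γ : Nuis ℓ) : ℝ :=
  deriv (fun θ' => m z θ' γ) θ

/-- The length `‖α‖₁` of a multi-index. -/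
def deg {ℓ : ℕ} (α : Fin ℓ → ℕ) : ℕ := ∑ i, α i

/-- `k = max_{α ∈ S} ‖α‖₁`. -/
def maxDeg {ℓ : ℕ} (S : Finset (Fin ℓ → ℕ)) : ℕ := S.sup deg

/-! ### Neighbourhoods and samples -/

/-- `E[∏ᵢ |hᵢ(X) - h₀ᵢ(X)|^{c αᵢ}]`, where `X` is the covariate part of `Z ∼ μ`. -/
def errMoment {p ℓ : ℕ} (μ : Measure (Data p)) (h₀ h : Cov p → Nuis ℓ)
    (c : ℕ) (α : Fin ℓ → ℕ) : ℝ≥0∞ :=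
  ∫⁻ z, ∏ i, ‖h z.2.2 i - h₀ z.2.2 i‖ₑ ^ (c * α i) ∂μ

/-- `{θ ∈ Θ : |θ - θ₀| ≤ r}`. -/
def thetaBall (Θ : Set ℝ) (θ₀ r : ℝ) : Set ℝ := {θ ∈ Θ | |θ - θ₀| ≤ r}

/-- `{h ∈ 𝓗 : E[∏ᵢ |hᵢ(X) - h₀ᵢ(X)|^{2αᵢ}] ≤ r for all α with 1 ≤ ‖α‖₁ ≤ k + 1}`. -/
def nuisBall {p ℓ : ℕ} (μ : Measure (Data p)) (𝓗 : Set (Cov p → Nuis ℓ))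
    (h₀ : Cov p → Nuis ℓ) (k : ℕ) (r : ℝ) : Set (Cov p → Nuis ℓ) :=
  {h ∈ 𝓗 | ∀ α : Fin ℓ → ℕ, 1 ≤ deg α → deg α ≤ k + 1 →
    errMoment μ h₀ h 2 α ≤ ENNReal.ofReal r}

/-- The law of `n` independent copies of `Z ∼ μ`. -/
def sampleLaw {p : ℕ} (μ : Measure (Data p)) (n : ℕ) : Measure (Fin n → Data p) :=
  Measure.pi fun _ => μ

/-- The law of the `2n` data points: the first component is the second-stage sample
`(Z_t)_{t ≤ n}`, the second component is the auxiliary sample `(Z_t)_{n < t ≤ 2n}`. -/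
def splitLaw {p : ℕ} (μ : Measure (Data p)) (n : ℕ) :
    Measure ((Fin n → Data p) × (Fin n → Data p)) :=
  (sampleLaw μ n).prod (sampleLaw μ n)

/-- A first-stage procedure: for each `n` an estimate of `h₀` computed from `n` data points. -/
abbrev FirstStage (p ℓ : ℕ) : Type :=
  (n : ℕ) → (Fin n → Data p) → Cov p → Nuis ℓ

/-- A second-stage procedure: for each `n` a real number computed from the second-stage sample
and the auxiliary sample. -/
abbrev SecondStage (p : ℕ) : Type :=
  (n : ℕ) → (Fin n → Data p) → (Fin n → Data p) → ℝ

/-- `hHat` is a (jointly measurable) estimator with values in `𝓗`. -/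
structure IsFirstStage {p ℓ : ℕ} (𝓗 : Set (Cov p → Nuis ℓ)) (hHat : FirstStage p ℓ) :
    Prop where
  measurable : ∀ n, Measurable fun q : (Fin n → Data p) × Cov p => hHat n q.1 q.2
  mem : ∀ n D, hHat n D ∈ 𝓗

/-- With probability tending to one, `θHat` lies in `Θ` and solves
`(1/n) ∑_{t ≤ n} m(Z_t, θ, ĥ(X_t)) = 0`, where `ĥ` is computed from the auxiliary sample. -/
def IsSampleSplitting {p ℓ : ℕ} (μ : Measure (Data p)) (Θ : Set ℝ) (m : Moment p ℓ)
    (hHat : FirstStage p ℓ) (θHat : SecondStage p) : Prop :=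
  Tendsto (fun n => splitLaw μ n
    {q | ¬ (θHat n q.1 q.2 ∈ Θ ∧
      (1 / (n : ℝ)) * ∑ t, m (q.1 t) (θHat n q.1 q.2) (hHat n q.2 (q.1 t).2.2) = 0)})
    atTop (𝓝 0)

/-- `θHat - θ₀ = O_P(1/√n)`. -/
def IsRootNConsistent {p : ℕ} (μ : Measure (Data p)) (θ₀ : ℝ) (θHat : SecondStage p) : Prop :=
  ∀ ε : ℝ, 0 < ε → ∃ R : ℝ, 0 < R ∧ ∃ N : ℕ, ∀ n, N < n →
    splitLaw μ n {q | R < |(θHat n q.1 q.2 - θ₀) / (1 / √(n : ℝ))|} ≤ ENNReal.ofReal ε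

/-- Convergence to `0` in probability of `W n`, a function of the auxiliary sample of size `n`. -/
def TendstoZeroInProb {p : ℕ} (μ : Measure (Data p))
    (W : (n : ℕ) → (Fin n → Data p) → ℝ≥0∞) : Prop :=
  ∀ ε : ℝ≥0∞, 0 < ε → Tendsto (fun n => sampleLaw μ n {D | ε < W n D}) atTop (𝓝 0)

/-! ### Conditions on the moment and on the first stage -/

/-- `∇^k m` exists and is continuous. The last three clauses say that the derivatives which
occur in the regularity conditions exist: those of order up to `k + 1` in `γ`, the derivative
`∇_θ m` (continuous, which only adds something if `k = 0`), and `∇_γ ∇_θ m`. -/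
structure Smoothness {p ℓ : ℕ} (m : Moment p ℓ) (k : ℕ) : Prop where
  contDiff : ContDiff ℝ k fun q : Data p × ℝ × Nuis ℓ => m q.1 q.2.1 q.2.2
  gamma : ∀ z θ, Differentiable ℝ (iteratedFDeriv ℝ k (m z θ))
  theta : ∀ z γ, Differentiable ℝ fun θ => m z θ γ
  theta_continuous : Continuous fun q : Data p × ℝ × Nuis ℓ => gradTheta m q.1 q.2.1 q.2.2
  gamma_theta : ∀ z θ, Differentiable ℝ (gradTheta m z θ)

/-- The regularity conditions on the moment, for a given radius `r`. -/
structure Regularity {p ℓ : ℕ} (μ : Measure (Data p)) (Θ : Set ℝ) (𝓗 : Set (Cov p → Nuis ℓ))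
    (m : Moment p ℓ) (θ₀ : ℝ) (h₀ : Cov p → Nuis ℓ) (k : ℕ) (r : ℝ) : Prop where
  theta_dominated :
    ∫⁻ z, ⨆ θ ∈ thetaBall Θ θ₀ r, ‖gradTheta m z θ (h₀ z.2.2)‖ₑ ∂μ < ∞
  gamma_theta_derivs :
    ⨆ h ∈ nuisBall μ 𝓗 h₀ k r,
      ∫⁻ z, ⨆ θ ∈ thetaBall Θ θ₀ r, ‖fderiv ℝ (gradTheta m z θ) (h z.2.2)‖ₑ ^ 2 ∂μ < ∞
  bounded_derivs :
    ⨆ α ∈ {α : Fin ℓ → ℕ | deg α ≤ k + 1}, ⨆ h ∈ nuisBall μ 𝓗 h₀ k r,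
      ∫⁻ z, ‖multiD α (m z θ₀) (h z.2.2)‖ₑ ^ 4 ∂μ < ∞
  moment_dominated : ∀ A ⊆ Θ, IsCompact A →
    ∫⁻ z, ⨆ θ ∈ A, ⨆ h ∈ nuisBall μ 𝓗 h₀ k r, ‖m z θ (h z.2.2)‖ₑ ∂μ < ∞
  gamma_deriv : ∀ A ⊆ Θ, IsCompact A →
    ⨆ θ ∈ A, ⨆ h ∈ nuisBall μ 𝓗 h₀ k r, ∫⁻ z, ‖fderiv ℝ (m z θ) (h z.2.2)‖ₑ ^ 2 ∂μ < ∞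

/-- All standard conditions on the moment and on the first-stage estimates, under the data law
`μ` with true parameters `(θ₀, h₀)`, *except* the non-degeneracy of `E[∇_θ m(Z, θ₀, h₀(X))]`.
The case `α = 0`, in which the error products are identically `1`, is left out of the
consistency and rate conditions and taken care of by `moment_condition`. -/
structure MainAssumptionsExceptNondegeneracy {p ℓ : ℕ} (μ : Measure (Data p)) (Θ : Set ℝ)
    (𝓗 : Set (Cov p → Nuis ℓ)) (m : Moment p ℓ) (S : Finset (Fin ℓ → ℕ))
    (hHat : FirstStage p ℓ) (θ₀ : ℝ) (h₀ : Cov p → Nuis ℓ) : Prop where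
  nonempty : S.Nonempty
  moment_condition : CondMeanZero μ (fun z => m z θ₀ (h₀ z.2.2)) (fun z => z.2.2)
  orthogonality : ∀ α ∈ S,
    CondMeanZero μ (fun z => multiD α (m z θ₀) (h₀ z.2.2)) (fun z => z.2.2)
  identifiability : ∀ θ ∈ Θ, θ ≠ θ₀ → ∫ z, m z θ (h₀ z.2.2) ∂μ ≠ 0
  smoothness : Smoothness m (maxDeg S)
  consistency : ∀ α ∈ S, α ≠ 0 →
    TendstoZeroInProb μ fun n D => errMoment μ h₀ (hHat n D) 4 α
  rate : ∀ α : Fin ℓ → ℕ, deg α ≤ maxDeg S + 1 → α ∉ S → α ≠ 0 →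
    TendstoZeroInProb μ fun n D =>
      (n : ℝ≥0∞) ^ (1 / 2 : ℝ) * errMoment μ h₀ (hHat n D) 2 α ^ (1 / 2 : ℝ)
  regularity : ∃ r : ℝ, 0 < r ∧ Regularity μ Θ 𝓗 m θ₀ h₀ (maxDeg S) r

/-! ### Parameter sets -/

/-- Every `θ₀ ∈ Θ` can be joined inside `Θ` by a segment to every sufficiently close point of
`Θ`. Intervals, open sets, and finite sets have this property. -/
def LocallyStarShaped (Θ : Set ℝ) : Prop :=
  ∀ θ₀ ∈ Θ, ∃ ρ : ℝ, 0 < ρ ∧ ∀ θ ∈ Θ, |θ - θ₀| ≤ ρ → segment ℝ θ₀ θ ⊆ Θ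

/-- Every `h₀ ∈ 𝓗` can be joined inside `𝓗` by a segment to every `h ∈ 𝓗` that is sufficiently
close to `h₀` in `L²(ν)`. Convex sets have this property. -/
def L2LocallyStarShaped {p ℓ : ℕ} (ν : Measure (Cov p)) (𝓗 : Set (Cov p → Nuis ℓ)) : Prop :=
  ∀ h₀ ∈ 𝓗, ∃ ρ : ℝ, 0 < ρ ∧ ∀ h ∈ 𝓗,
    ∫⁻ x, ‖h x - h₀ x‖ₑ ^ 2 ∂ν ≤ ENNReal.ofReal ρ → segment ℝ h₀ h ⊆ 𝓗

end

/-! ### Probabilistic tools -/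

/-! Fix `h₀` and two points `θ₀ ≠ θ₁` of `Θ`. At the truth `(θ₁, h₀)` a root `θ̂` of the empirical
moment lies within `R/√n` of `θ₁` with high probability. Expanding in `θ`, the sum of `m(Z_t, θ₁,
ĥ)` divided by `√n` equals `-√n(θ̂ - θ₁)` times an averaged `θ`-gradient, up to a small error. The
gradient has mean zero, so its average vanishes by the law of large numbers, and the normalized sum
tends to 0 in probability (`measure_pi_exists_root_le`).

A sum of i.i.d. terms on the scale `√n` can vanish only if its terms are asymptotically constant;
characteristic functions show this without centering or second moments
(`ae_eq_const_of_frequently_measure_pi_abs_sum_gt_le`). As `m(·, θ₁, ĥ)` is L¹-close to `m(·, θ₁,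
h₀)`, the latter is a.s. constant, hence zero by the moment condition (`moment_ae_eq_zero`).

Full support of the noise and continuity of `m` upgrade this to `m(t, y, x, θ₁, h₀(x)) = 0` for all
`t, y` and almost every `x` (`ae_forall_of_ae_plrLaw`). The law of `X` is the same under `(θ₀, h₀)`,
so identifiability of `θ₀` fails at `θ₁`. -/

/-- Weak law of large numbers. The product spaces change with `n`, so the strong law is applied on
one infinite product, whose first `n` coordinates have the law `μ^n`. -/
theorem tendsto_measure_pi_abs_sum_gt {Z : Type*} [MeasurableSpace Z] (μ : Measure Z)
    [IsProbabilityMeasure μ] {F : Z → ℝ} (hFm : Measurable F) (hF : Integrable F μ)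
    (h0 : ∫ z, F z ∂μ = 0) {a : ℝ} (ha : 0 < a) :
    Tendsto (fun n : ℕ => Measure.pi (fun _ : Fin n => μ) {z | a * n < |∑ t, F (z t)|})
      atTop (𝓝 0) := by
  set Q : Measure (ℕ → Z) := Measure.infinitePi fun _ => μ with hQ
  have hmp : ∀ i : ℕ, MeasurePreserving (fun ω : ℕ → Z => ω i) Q μ := fun i =>
    measurePreserving_eval_infinitePi (fun _ => μ) i
  have hind : iIndepFun (fun (i : ℕ) (ω : ℕ → Z) => ω i) Q :=
    iIndepFun_infinitePi (P := fun _ : ℕ => μ) (X := fun _ z => z) (fun _ => measurable_id)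
  have hindF : iIndepFun (fun (i : ℕ) (ω : ℕ → Z) => F (ω i)) Q :=
    iIndepFun_infinitePi (P := fun _ : ℕ => μ) (X := fun _ z => F z) (fun _ => hFm)
  have hmap : ∀ n : ℕ, Q.map (fun ω (t : Fin n) => ω t) = Measure.pi fun _ : Fin n => μ := by
    intro n
    have h1 := hind.precomp (g := fun t : Fin n => (t : ℕ)) Fin.val_injective
    have h2 := (iIndepFun_iff_map_fun_eq_pi_map
      fun t : Fin n => (hmp t).measurable.aemeasurable).1 h1
    refine h2.trans ?_
    congr 1
    ext1 t
    exact (hmp t).map_eq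
  have hint : Integrable (fun ω : ℕ → Z => F (ω 0)) Q :=
    ((hmp 0).integrable_comp hFm.aestronglyMeasurable).2 hF
  have hlln := strong_law_ae_real (μ := Q) (fun i ω => F (ω i)) hint
    (fun i j hij => hindF.indepFun hij)
    (fun i => ⟨(hFm.comp (hmp i).measurable).aemeasurable,
      (hFm.comp (hmp 0).measurable).aemeasurable, by
        have e : ∀ i, Q.map (fun ω : ℕ → Z => F (ω i)) = μ.map F := fun i => by
          rw [← (hmp i).map_eq, Measure.map_map hFm (hmp i).measurable]; rfl
        rw [e i, e 0]⟩)
  have hzero : Q[fun ω : ℕ → Z => F (ω 0)] = 0 := by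
    rw [← h0, ← (hmp 0).map_eq,
      integral_map (hmp 0).measurable.aemeasurable hFm.aestronglyMeasurable]
  simp only [hzero] at hlln
  have hmeas : ∀ n : ℕ, Measurable fun ω : ℕ → Z => (∑ i ∈ Finset.range n, F (ω i)) / n :=
    fun n => (Finset.measurable_sum _ fun i _ => hFm.comp (hmp i).measurable).div_const _
  have hTM := tendstoInMeasure_of_tendsto_ae (μ := Q) (fun n => (hmeas n).aestronglyMeasurable) hlln
  have h2 := hTM (ENNReal.ofReal a) (by simpa using ha)
  refine tendsto_of_tendsto_of_tendsto_of_le_of_le' tendsto_const_nhds h2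
    (Eventually.of_forall fun _ => zero_le) ?_
  filter_upwards [eventually_gt_atTop 0] with n hn
  have hn' : (0 : ℝ) < n := by exact_mod_cast hn
  have hms : MeasurableSet {z : Fin n → Z | a * n < |∑ t, F (z t)|} :=
    measurableSet_lt measurable_const
      (Finset.measurable_sum _ fun t _ => hFm.comp (measurable_pi_apply t)).abs
  rw [← hmap n, Measure.map_apply (by fun_prop) hms]
  refine measure_mono fun ω hω => ?_
  simp only [Set.mem_preimage, Set.mem_ofPred_eq, Finset.sum_range, edist_dist, Real.dist_eq,
    sub_zero, abs_div, Nat.abs_cast] at hω ⊢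
  refine ENNReal.ofReal_le_ofReal ?_
  rw [le_div_iff₀ hn']
  exact hω.le

/-! ### Increments bounded by integrals of derivatives. -/

/-- The fundamental theorem of calculus needs `g'` integrable; otherwise the right side is infinite,
so no continuity of `g'` is required. -/
theorem enorm_sub_le_lintegral_of_hasDerivAt {g g' : ℝ → ℝ} (hg : ∀ s, HasDerivAt g (g' s) s)
    (a b : ℝ) : ‖g b - g a‖ₑ ≤ ∫⁻ s in Set.uIcc a b, ‖g' s‖ₑ := by
  have hg'm : Measurable g' := by
    have : g' = deriv g := funext fun s => (hg s).deriv.symm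
    rw [this]; exact measurable_deriv g
  have hle : ∫⁻ s in Set.uIoc a b, ‖g' s‖ₑ ≤ ∫⁻ s in Set.uIcc a b, ‖g' s‖ₑ :=
    lintegral_mono_set Set.uIoc_subset_uIcc
  refine le_trans ?_ hle
  by_cases hfin : ∫⁻ s in Set.uIoc a b, ‖g' s‖ₑ < ∞
  · have hii : IntervalIntegrable g' volume a b :=
      intervalIntegrable_iff.2 ⟨hg'm.aestronglyMeasurable, hfin⟩
    rw [← intervalIntegral.integral_eq_sub_of_hasDerivAt (fun s _ => hg s) hii,
      ← enorm_norm, intervalIntegral.norm_integral_eq_norm_integral_uIoc, enorm_norm]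
    exact enorm_integral_le_lintegral_enorm _
  · rw [not_lt, top_le_iff] at hfin
    rw [hfin]; exact le_top

/-- Integrate the derivative along the segment from `h₀` to `h`, exchange integrals by Tonelli, and
apply Cauchy–Schwarz for each `s`. It serves both for `m` and for its `θ`-gradient. -/
theorem lintegral_enorm_sub_le {p ℓ : ℕ} (μ : Measure (Data p)) [SFinite μ]
    {F : Data p → Nuis ℓ → ℝ} (hFc : Continuous F.uncurry) (hFd : ∀ z, Differentiable ℝ (F z))
    {h h₀ : Cov p → Nuis ℓ} (hh : Measurable h) (hh₀ : Measurable h₀) {C : ℝ≥0∞}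
    (hC : ∀ s ∈ Set.Icc (0 : ℝ) 1,
      ∫⁻ z, ‖fderiv ℝ (F z) (h₀ z.2.2 + s • (h z.2.2 - h₀ z.2.2))‖ₑ ^ 2 ∂μ ≤ C) :
    ∫⁻ z, ‖F z (h z.2.2) - F z (h₀ z.2.2)‖ₑ ∂μ ≤
      C ^ (1 / 2 : ℝ) * (∫⁻ z, ‖h z.2.2 - h₀ z.2.2‖ₑ ^ 2 ∂μ) ^ (1 / 2 : ℝ) := by
  have hd : Measurable fun q : Data p × Nuis ℓ => fderiv ℝ (F q.1) q.2 :=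
    measurable_fderiv_with_param ℝ hFc
  have hx : Measurable fun z : Data p => z.2.2 := by fun_prop
  have hdiff : Measurable fun z : Data p => h z.2.2 - h₀ z.2.2 := (hh.comp hx).sub (hh₀.comp hx)
  have hpt : ∀ z, ‖F z (h z.2.2) - F z (h₀ z.2.2)‖ₑ ≤
      ∫⁻ s in Set.Icc (0 : ℝ) 1, ‖fderiv ℝ (F z) (h₀ z.2.2 + s • (h z.2.2 - h₀ z.2.2))‖ₑ *
        ‖h z.2.2 - h₀ z.2.2‖ₑ := by
    intro z
    have hg : ∀ s : ℝ, HasDerivAt (fun s : ℝ => F z (h₀ z.2.2 + s • (h z.2.2 - h₀ z.2.2)))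
        (fderiv ℝ (F z) (h₀ z.2.2 + s • (h z.2.2 - h₀ z.2.2)) (h z.2.2 - h₀ z.2.2)) s := by
      intro s
      have h1 : HasDerivAt (fun s : ℝ => h₀ z.2.2 + s • (h z.2.2 - h₀ z.2.2))
          (h z.2.2 - h₀ z.2.2) s := by
        simpa using ((hasDerivAt_id s).smul_const (h z.2.2 - h₀ z.2.2)).const_add (h₀ z.2.2)
      exact (hFd z _).hasFDerivAt.comp_hasDerivAt s h1
    have := enorm_sub_le_lintegral_of_hasDerivAt hg 0 1
    simp only [one_smul, zero_smul, add_zero, add_sub_cancel, Set.uIcc_of_le zero_le_one] at this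
    refine this.trans (lintegral_mono fun s => ?_)
    exact ContinuousLinearMap.le_opENorm _ _
  have hmeas : Measurable fun q : Data p × ℝ =>
      ‖fderiv ℝ (F q.1) (h₀ q.1.2.2 + q.2 • (h q.1.2.2 - h₀ q.1.2.2))‖ₑ *
        ‖h q.1.2.2 - h₀ q.1.2.2‖ₑ := by
    have e1 : Measurable fun q : Data p × ℝ => h q.1.2.2 - h₀ q.1.2.2 :=
      hdiff.comp measurable_fst
    have e2 : Measurable fun q : Data p × ℝ => h₀ q.1.2.2 + q.2 • (h q.1.2.2 - h₀ q.1.2.2) :=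
      ((hh₀.comp hx).comp measurable_fst).add (measurable_snd.smul e1)
    exact (hd.comp (measurable_fst.prodMk e2)).enorm.mul e1.enorm
  refine (lintegral_mono hpt).trans ?_
  rw [lintegral_lintegral_swap hmeas.aemeasurable]
  have hbound : ∀ s ∈ Set.Icc (0 : ℝ) 1,
      ∫⁻ z, ‖fderiv ℝ (F z) (h₀ z.2.2 + s • (h z.2.2 - h₀ z.2.2))‖ₑ *
        ‖h z.2.2 - h₀ z.2.2‖ₑ ∂μ ≤
      C ^ (1 / 2 : ℝ) * (∫⁻ z, ‖h z.2.2 - h₀ z.2.2‖ₑ ^ 2 ∂μ) ^ (1 / 2 : ℝ) := by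
    intro s hs
    have e2 : Measurable fun z : Data p => h₀ z.2.2 + s • (h z.2.2 - h₀ z.2.2) :=
      (hh₀.comp hx).add (hdiff.const_smul s)
    have hf : Measurable fun z => ‖fderiv ℝ (F z) (h₀ z.2.2 + s • (h z.2.2 - h₀ z.2.2))‖ₑ :=
      (hd.comp (measurable_id.prodMk e2)).enorm
    have := ENNReal.lintegral_mul_le_Lp_mul_Lq μ Real.HolderConjugate.two_two
      hf.aemeasurable hdiff.enorm.aemeasurable
    simp only [Pi.mul_apply, ENNReal.rpow_ofNat] at this
    refine this.trans ?_
    gcongr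
    exact hC s hs
  calc _ ≤ ∫⁻ s in Set.Icc (0 : ℝ) 1, C ^ (1 / 2 : ℝ) *
        (∫⁻ z, ‖h z.2.2 - h₀ z.2.2‖ₑ ^ 2 ∂μ) ^ (1 / 2 : ℝ) :=
        setLIntegral_mono' measurableSet_Icc hbound
    _ = _ := by simp

/-! ### Small normalized sums force constancy. -/

/-- Let `φ` be the characteristic function of `v` at `1/√n`. Then `φ^n` is near 1, while `‖φ‖²` is
the mean of `cos((v - v')/√n)` for an independent copy `v'`. So `n · E[1 - cos((v - v')/√n)]` is
small, and Markov's inequality applies where `1 - cos` is quadratic; the cutoff `√n` keeps the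
argument there. -/
theorem measure_prod_le_of_measure_pi_abs_sum_gt_le {Z : Type*} [MeasurableSpace Z]
    (μ : Measure Z) [IsProbabilityMeasure μ] {v : Z → ℝ} (hv : Measurable v) {n : ℕ} (hn : 0 < n)
    {ε : ℝ} (hε : 0 < ε) (hε' : ε ≤ 1 / 12)
    (h : Measure.pi (fun _ : Fin n => μ) {z | ε < |(∑ t, v (z t)) / √n|} ≤ ENNReal.ofReal ε)
    {η : ℝ} (hη : 0 < η) :
    (μ.prod μ) {q | η ≤ |v q.1 - v q.2| ∧ |v q.1 - v q.2| ≤ √n} ≤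
      ENNReal.ofReal (60 * ε / η ^ 2) := by
  have hn0 : (0 : ℝ) < n := by exact_mod_cast hn
  have hs : 0 < √(n : ℝ) := Real.sqrt_pos.2 hn0
  set φ : ℂ := ∫ z, Complex.exp (Complex.I * ((v z / √n : ℝ) : ℂ)) ∂μ with hφ
  have hpow : ∫ z, Complex.exp (Complex.I * (((∑ t, v (z t)) / √n : ℝ) : ℂ))
      ∂(Measure.pi fun _ : Fin n => μ) = φ ^ n := by
    have := integral_fintype_prod_eq_pow (ι := Fin n) (μ := μ)
      (fun z => Complex.exp (Complex.I * ((v z / √n : ℝ) : ℂ)))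
    rw [Fintype.card_fin] at this
    rw [hφ, ← this]
    refine integral_congr_ae (Eventually.of_forall fun z => ?_)
    simp only [← Complex.exp_sum, ← Finset.mul_sum, Finset.sum_div, Complex.ofReal_sum]
  have hTm : Measurable fun z : Fin n → Z => (∑ t, v (z t)) / √n :=
    (Finset.measurable_sum _ fun t _ => hv.comp (measurable_pi_apply t)).div_const _
  have hnorm : ∀ x : ℝ, ‖Complex.exp (Complex.I * (x : ℂ))‖ = 1 := fun x => by
    rw [mul_comm]; exact Complex.norm_exp_ofReal_mul_I x
  have hexpm : Measurable fun z : Fin n → Z =>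
      Complex.exp (Complex.I * (((∑ t, v (z t)) / √n : ℝ) : ℂ)) := by fun_prop
  -- The integrand is at most `ε` off the exceptional event and at most 2 on it, an event of
  -- probability at most `ε`.
  have hclose : ‖φ ^ n - 1‖ ≤ 3 * ε := by
    have hi : Integrable (fun z : Fin n → Z =>
        Complex.exp (Complex.I * (((∑ t, v (z t)) / √n : ℝ) : ℂ)))
        (Measure.pi fun _ : Fin n => μ) :=
      Integrable.of_bound hexpm.aestronglyMeasurable 1
        (Eventually.of_forall fun z => (hnorm _).le)
    have h1 : φ ^ n - 1 = ∫ z, (Complex.exp (Complex.I * (((∑ t, v (z t)) / √n : ℝ) : ℂ)) - 1)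
        ∂(Measure.pi fun _ : Fin n => μ) := by
      rw [integral_sub hi (integrable_const _), hpow]; simp
    have h2 : ‖φ ^ n - 1‖ₑ ≤ ENNReal.ofReal (3 * ε) := by
      rw [h1]
      refine (enorm_integral_le_lintegral_enorm _).trans ?_
      have hA : MeasurableSet {z : Fin n → Z | ε < |(∑ t, v (z t)) / √n|} :=
        measurableSet_lt measurable_const hTm.abs
      calc _ ≤ ∫⁻ z, (ENNReal.ofReal ε +
            {z : Fin n → Z | ε < |(∑ t, v (z t)) / √n|}.indicator (fun _ => 2) z)
            ∂(Measure.pi fun _ : Fin n => μ) := by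
            refine lintegral_mono fun z => ?_
            by_cases hz : ε < |(∑ t, v (z t)) / √n|
            · rw [Set.indicator_of_mem (by exact hz)]
              refine le_add_left ?_
              rw [← ofReal_norm, ← ENNReal.ofReal_ofNat]
              refine ENNReal.ofReal_le_ofReal ((norm_sub_le _ _).trans ?_)
              rw [hnorm, norm_one]; norm_num
            · rw [Set.indicator_of_notMem (by exact hz), add_zero]
              rw [← ofReal_norm]
              refine ENNReal.ofReal_le_ofReal (Real.norm_exp_I_mul_ofReal_sub_one_le.trans ?_)
              exact not_lt.1 hz
        _ ≤ ENNReal.ofReal (3 * ε) := by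
            rw [lintegral_add_left measurable_const, lintegral_indicator_const hA]
            simp only [lintegral_const, measure_univ, mul_one]
            calc _ ≤ ENNReal.ofReal ε + 2 * ENNReal.ofReal ε := by gcongr
              _ = ENNReal.ofReal (3 * ε) := by
                rw [ENNReal.ofReal_mul (by norm_num)]
                simp only [ENNReal.ofReal_ofNat]
                ring
    rw [← ofReal_norm] at h2
    exact (ENNReal.ofReal_le_ofReal_iff (by positivity)).1 h2
  have hlow : 1 - 3 * ε ≤ ‖φ‖ ^ n := by
    have h1 : ‖(1 : ℂ)‖ ≤ ‖φ ^ n‖ + ‖φ ^ n - 1‖ := by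
      have := norm_sub_le (φ ^ n) (φ ^ n - 1)
      simpa using this
    rw [norm_one, norm_pow] at h1
    linarith
  have hcosm : Measurable fun q : Z × Z => 1 - Real.cos ((v q.1 - v q.2) / √n) := by fun_prop
  set x : ℝ := ∫ q, (1 - Real.cos ((v q.1 - v q.2) / √n)) ∂(μ.prod μ) with hx
  have hcosi : Integrable (fun q : Z × Z => 1 - Real.cos ((v q.1 - v q.2) / √n)) (μ.prod μ) := by
    refine Integrable.of_bound hcosm.aestronglyMeasurable 2 (Eventually.of_forall fun q => ?_)
    rw [Real.norm_eq_abs, abs_le]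
    constructor <;> linarith [Real.cos_le_one ((v q.1 - v q.2) / √n),
      Real.neg_one_le_cos ((v q.1 - v q.2) / √n)]
  have hx0 : 0 ≤ x := integral_nonneg fun q => by
    simpa using Real.cos_le_one ((v q.1 - v q.2) / √n)
  have hsq : ‖φ‖ ^ 2 = 1 - x := by
    have hfi : Integrable (fun q : Z × Z => Complex.exp
        (Complex.I * ((v q.1 / √n : ℝ) : ℂ)) *
          (starRingEnd ℂ) (Complex.exp (Complex.I * ((v q.2 / √n : ℝ) : ℂ)))) (μ.prod μ) := by
      refine Integrable.of_bound (Measurable.aestronglyMeasurable (by fun_prop)) 1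
        (Eventually.of_forall fun q => ?_)
      rw [norm_mul, RCLike.norm_conj, hnorm, hnorm, mul_one]
    have h1 : φ * (starRingEnd ℂ) φ = ∫ q : Z × Z, Complex.exp
        (Complex.I * ((v q.1 / √n : ℝ) : ℂ)) *
          (starRingEnd ℂ) (Complex.exp (Complex.I * ((v q.2 / √n : ℝ) : ℂ))) ∂(μ.prod μ) := by
      rw [hφ, ← integral_conj]
      exact (integral_prod_mul _ _).symm
    have h2 := congrArg Complex.re h1
    rw [Complex.mul_conj, Complex.ofReal_re, Complex.normSq_eq_norm_sq] at h2
    rw [h2]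
    have h3 : (∫ q : Z × Z, Complex.exp
        (Complex.I * ((v q.1 / √n : ℝ) : ℂ)) *
          (starRingEnd ℂ) (Complex.exp (Complex.I * ((v q.2 / √n : ℝ) : ℂ))) ∂(μ.prod μ)).re =
        ∫ q : Z × Z, Real.cos ((v q.1 - v q.2) / √n) ∂(μ.prod μ) := by
      rw [← RCLike.re_eq_complex_re, ← integral_re hfi]
      refine integral_congr_ae (Eventually.of_forall fun q => ?_)
      simp only [RCLike.re_eq_complex_re]
      rw [← Complex.exp_conj, ← Complex.exp_add, map_mul, Complex.conj_I, Complex.conj_ofReal]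
      have : Complex.I * ((v q.1 / √n : ℝ) : ℂ) + -Complex.I * ((v q.2 / √n : ℝ) : ℂ) =
          (((v q.1 - v q.2) / √n : ℝ) : ℂ) * Complex.I := by
        push_cast; ring
      rw [this, Complex.exp_ofReal_mul_I_re]
    rw [h3, hx, integral_sub (integrable_const _)]
    · simp
    · have := (integrable_const (μ := μ.prod μ) (1 : ℝ)).sub hcosi
      refine this.congr (Eventually.of_forall fun q => ?_)
      simp
  -- Bernoulli's `1 + nx ≤ (1 + x)^n` and `(1 - x²)^n ≤ 1` give `(1 - 6ε)(1 + nx) ≤ 1`; then `ε ≤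
  -- 1/12` makes `1 - 6ε ≥ 1/2`.
  have hnx : n * x ≤ 12 * ε := by
    have hx1 : 0 ≤ 1 - x := hsq ▸ sq_nonneg _
    have h1 : (1 - 3 * ε) ^ 2 ≤ (1 - x) ^ n := by
      rw [← hsq, ← pow_mul, mul_comm 2 n, pow_mul]
      exact pow_le_pow_left₀ (by linarith) hlow 2
    have h2 : 1 + n * x ≤ (1 + x) ^ n := one_add_mul_le_pow (by linarith) n
    have h3 : (1 - x) ^ n * (1 + x) ^ n ≤ 1 := by
      rw [← mul_pow]
      exact pow_le_one₀ (mul_nonneg hx1 (by linarith)) (by nlinarith)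
    have h4 : (1 - 3 * ε) ^ 2 * (1 + n * x) ≤ 1 :=
      (mul_le_mul h1 h2 (by positivity) (pow_nonneg hx1 n)).trans h3
    have hnx0 : 0 ≤ n * x := by positivity
    have h5 : (1 - 6 * ε) * (1 + n * x) ≤ 1 := by
      refine le_trans ?_ h4
      gcongr
      nlinarith
    nlinarith
  -- `1 - cos u ≥ (2/π²)u² ≥ u²/5` for `|u| ≤ 1`, since `π² ≤ 10`. The final constant is `60 = 12 ·
  -- 5`.
  have hsub : {q : Z × Z | η ≤ |v q.1 - v q.2| ∧ |v q.1 - v q.2| ≤ √n} ⊆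
      {q | η ^ 2 / (5 * n) ≤ 1 - Real.cos ((v q.1 - v q.2) / √n)} := by
    rintro q ⟨h1, h2⟩
    set V := v q.1 - v q.2
    have hy : |V / √n| ≤ 1 := by
      rw [abs_div, abs_of_pos hs, div_le_one hs]; exact h2
    have h3 := Real.cos_le_one_sub_mul_cos_sq (hy.trans (by linarith [Real.pi_gt_three]))
    have h4 : (V / √n) ^ 2 = V ^ 2 / n := by rw [div_pow, Real.sq_sqrt hn0.le]
    have h5 : η ^ 2 ≤ V ^ 2 := by rw [← sq_abs V]; gcongr
    have h6 : 1 / 5 ≤ 2 / Real.pi ^ 2 := by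
      rw [div_le_div_iff₀ (by norm_num) (by positivity)]
      nlinarith [Real.pi_lt_d2, Real.pi_gt_three]
    have h7 : η ^ 2 / (5 * n) ≤ 2 / Real.pi ^ 2 * (V / √n) ^ 2 := by
      rw [h4]
      calc η ^ 2 / (5 * n) = 1 / 5 * (η ^ 2 / n) := by field_simp
        _ ≤ _ := by gcongr
    simp only [Set.mem_ofPred_eq]
    linarith
  refine (measure_mono hsub).trans ?_
  have hmark := mul_meas_ge_le_integral_of_nonneg (μ := μ.prod μ)
    (f := fun q : Z × Z => 1 - Real.cos ((v q.1 - v q.2) / √n))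
    (Eventually.of_forall fun q => by simpa using Real.cos_le_one ((v q.1 - v q.2) / √n))
    hcosi (η ^ 2 / (5 * n))
  rw [← ofReal_measureReal]
  refine ENNReal.ofReal_le_ofReal ?_
  rw [le_div_iff₀ (by positivity)]
  have h8 : η ^ 2 / (5 * n) * (μ.prod μ).real
      {q | η ^ 2 / (5 * n) ≤ 1 - Real.cos ((v q.1 - v q.2) / √n)} * (5 * n) ≤ x * (5 * n) := by
    gcongr
  have h9 : ∀ m : ℝ, η ^ 2 / (5 * n) * m * (5 * n) = m * η ^ 2 := fun m => by field_simp
  rw [h9] at h8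
  linarith

/-- The approximant `v` may change with `n` and `ε`, and one large `n` per `ε` is enough. Letting `ε
→ 0` shows that two independent draws of `w` agree a.s.; Fubini then fixes one of them. -/
theorem ae_eq_const_of_frequently_measure_pi_abs_sum_gt_le {Z : Type*} [MeasurableSpace Z]
    (μ : Measure Z) [IsProbabilityMeasure μ] {w : Z → ℝ} (hw : Measurable w)
    (h : ∀ ε : ℝ, 0 < ε → ∃ᶠ n : ℕ in atTop, ∃ v : Z → ℝ, Measurable v ∧
      ∫⁻ z, ‖v z - w z‖ₑ ∂μ ≤ ENNReal.ofReal ε ∧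
      Measure.pi (fun _ : Fin n => μ) {z | ε < |(∑ t, v (z t)) / √n|} ≤ ENNReal.ofReal ε) :
    ∃ c : ℝ, w =ᵐ[μ] fun _ => c := by
  -- Passing from `w` to `v` costs one `η` in each bound, by Markov's inequality; for large `n` the
  -- cutoff `√n` exceeds `K + η`.
  have key : ∀ (η K : ℝ), 0 < η → (μ.prod μ) {q | 2 * η ≤ |w q.1 - w q.2| ∧
      |w q.1 - w q.2| ≤ K} = 0 := by
    intro η K hη
    have hbd : ∀ ε : ℝ, 0 < ε → ε ≤ 1 / 12 → (μ.prod μ) {q | 2 * η ≤ |w q.1 - w q.2| ∧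
        |w q.1 - w q.2| ≤ K} ≤ ENNReal.ofReal (60 * ε / η ^ 2 + 2 * ε / η) := by
      intro ε hε hε'
      have hlarge : ∀ᶠ n : ℕ in atTop, 0 < n ∧ K + η ≤ √(n : ℝ) :=
        (eventually_gt_atTop 0).and ((Real.tendsto_sqrt_atTop.comp
          tendsto_natCast_atTop_atTop).eventually_ge_atTop (K + η))
      obtain ⟨n, ⟨v, hv, hvw, hpi⟩, hn, hnK⟩ := ((h ε hε).and_eventually hlarge).exists
      have h1 := measure_prod_le_of_measure_pi_abs_sum_gt_le μ hv hn hε hε' hpi hη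
      have hdm : Measurable fun q : Z × Z => ‖v q.1 - w q.1‖ₑ + ‖v q.2 - w q.2‖ₑ := by fun_prop
      have h2 : (μ.prod μ) {q | ENNReal.ofReal η ≤ ‖v q.1 - w q.1‖ₑ + ‖v q.2 - w q.2‖ₑ} ≤
          ENNReal.ofReal (2 * ε / η) := by
        refine (meas_ge_le_lintegral_div hdm.aemeasurable (by simpa using hη)
          ENNReal.ofReal_ne_top).trans ?_
        rw [ENNReal.ofReal_div_of_pos hη]
        gcongr
        rw [lintegral_add_left (by fun_prop)]
        have e1 : ∫⁻ q : Z × Z, ‖v q.1 - w q.1‖ₑ ∂(μ.prod μ) = ∫⁻ z, ‖v z - w z‖ₑ ∂μ :=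
          (measurePreserving_fst (μ := μ) (ν := μ)).lintegral_comp
            (f := fun z => ‖v z - w z‖ₑ) (by fun_prop)
        have e2 : ∫⁻ q : Z × Z, ‖v q.2 - w q.2‖ₑ ∂(μ.prod μ) = ∫⁻ z, ‖v z - w z‖ₑ ∂μ :=
          (measurePreserving_snd (μ := μ) (ν := μ)).lintegral_comp
            (f := fun z => ‖v z - w z‖ₑ) (by fun_prop)
        rw [e1, e2, two_mul, ENNReal.ofReal_add hε.le hε.le]
        gcongr
      rw [ENNReal.ofReal_add (by positivity) (by positivity)]
      refine le_trans (measure_mono ?_) ((measure_union_le _ _).trans (add_le_add h1 h2))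
      rintro q ⟨ha, hb⟩
      by_cases hq : ENNReal.ofReal η ≤ ‖v q.1 - w q.1‖ₑ + ‖v q.2 - w q.2‖ₑ
      · exact Or.inr hq
      · left
        rw [← ofReal_norm, ← ofReal_norm, ← ENNReal.ofReal_add (norm_nonneg _) (norm_nonneg _),
          ENNReal.ofReal_le_ofReal_iff (by positivity), not_le, Real.norm_eq_abs,
          Real.norm_eq_abs] at hq
        have h3 : |(v q.1 - v q.2) - (w q.1 - w q.2)| < η := by
          refine lt_of_le_of_lt ?_ hq
          rw [show v q.1 - v q.2 - (w q.1 - w q.2) = (v q.1 - w q.1) - (v q.2 - w q.2) by ring]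
          exact abs_sub _ _
        have h4 := abs_sub_abs_le_abs_sub (v q.1 - v q.2) (w q.1 - w q.2)
        have h5 := abs_sub_abs_le_abs_sub (w q.1 - w q.2) (v q.1 - v q.2)
        rw [abs_sub_comm (w q.1 - w q.2) (v q.1 - v q.2)] at h5
        exact ⟨by linarith, by linarith⟩
    have hlim : Tendsto (fun ε : ℝ => ENNReal.ofReal (60 * ε / η ^ 2 + 2 * ε / η)) (𝓝[>] 0)
        (𝓝 0) := by
      have : Continuous fun ε : ℝ => ENNReal.ofReal (60 * ε / η ^ 2 + 2 * ε / η) :=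
        ENNReal.continuous_ofReal.comp (by fun_prop)
      have h0 := this.tendsto 0
      simp only [mul_zero, zero_div, add_zero, ENNReal.ofReal_zero] at h0
      exact h0.mono_left nhdsWithin_le_nhds
    refine le_antisymm (ge_of_tendsto hlim ?_) zero_le
    filter_upwards [Ioc_mem_nhdsGT (show (0 : ℝ) < 1 / 12 by norm_num)] with ε hε
    exact hbd ε hε.1 hε.2
  have hae : ∀ᵐ q ∂(μ.prod μ), w q.1 = w q.2 := by
    have : ∀ᵐ q ∂(μ.prod μ), ∀ N : ℕ, ¬ (2 * (1 / ((N : ℝ) + 1)) ≤ |w q.1 - w q.2| ∧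
        |w q.1 - w q.2| ≤ N) :=
      ae_all_iff.2 fun N => by
        rw [ae_iff]
        simpa only [not_not] using key (1 / ((N : ℝ) + 1)) N (by positivity)
    filter_upwards [this] with q hq
    by_contra hne
    have hpos : 0 < |w q.1 - w q.2| := abs_pos.2 (sub_ne_zero.2 hne)
    obtain ⟨N, hN⟩ := exists_nat_ge (max |w q.1 - w q.2| (2 / |w q.1 - w q.2|))
    refine hq N ⟨?_, (le_max_left _ _).trans hN⟩
    rw [mul_one_div, div_le_iff₀ (by positivity)]
    have := (div_le_iff₀ hpos).1 ((le_max_right _ _).trans hN)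
    nlinarith
  obtain ⟨z₀, hz₀⟩ := (Measure.ae_ae_of_ae_prod hae).exists
  exact ⟨w z₀, by filter_upwards [hz₀] with z hz using hz.symm⟩

/-! ### Increments of the empirical moment in `θ` -/

/-- Dominated convergence. The supremum over `I` may fail to be measurable, so the dominating
function is the supremum over a countable dense subset, which by continuity bounds every `θ ∈ I`. -/
theorem tendsto_lintegral_enorm_sub_of_lintegral_iSup_lt_top {Z : Type*} [MeasurableSpace Z]
    {μ : Measure Z} {D : Z → ℝ → ℝ} (hDm : ∀ θ, Measurable fun z => D z θ)
    (hDc : ∀ z, Continuous (D z)) {I : Set ℝ} {θ₀ : ℝ} (hθ₀ : θ₀ ∈ I)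
    (hI : ∫⁻ z, ⨆ θ ∈ I, ‖D z θ‖ₑ ∂μ < ∞) :
    Tendsto (fun θ => ∫⁻ z, ‖D z θ - D z θ₀‖ₑ ∂μ) (𝓝[I] θ₀) (𝓝 0) := by
  have : Nonempty I := ⟨⟨θ₀, hθ₀⟩⟩
  obtain ⟨u, hu⟩ := TopologicalSpace.exists_dense_seq I
  set G : Z → ℝ≥0∞ := fun z => ⨆ i, ‖D z (u i)‖ₑ with hG
  have hGm : Measurable G := Measurable.iSup fun i => (hDm (u i)).enorm
  have hGle : ∀ z, ∀ θ ∈ I, ‖D z θ‖ₑ ≤ G z := by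
    intro z θ hθ
    have hcl : IsClosed {θ : I | ‖D z θ‖ₑ ≤ G z} :=
      isClosed_le (((hDc z).comp continuous_subtype_val).enorm) continuous_const
    have hsub : Set.range u ⊆ {θ : I | ‖D z θ‖ₑ ≤ G z} := by
      rintro _ ⟨i, rfl⟩
      exact le_iSup (fun i => ‖D z (u i)‖ₑ) i
    have := hcl.closure_subset_iff.2 hsub (hu ⟨θ, hθ⟩)
    exact this
  have hGfin : ∫⁻ z, G z ∂μ < ∞ := by
    refine lt_of_le_of_lt (lintegral_mono fun z => iSup_le fun i => ?_) hI
    exact le_iSup₂ (f := fun θ (_ : θ ∈ I) => ‖D z θ‖ₑ) (u i : ℝ) (u i).2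
  have h0 : ∫⁻ z, ‖D z θ₀ - D z θ₀‖ₑ ∂μ = 0 := by simp
  rw [← h0]
  refine tendsto_lintegral_filter_of_dominated_convergence (fun z => G z + G z)
    (Eventually.of_forall fun θ => ((hDm θ).sub (hDm θ₀)).enorm) ?_ ?_ ?_
  · filter_upwards [self_mem_nhdsWithin] with θ hθ
    refine Eventually.of_forall fun z => ?_
    exact enorm_sub_le.trans (add_le_add (hGle z θ hθ) (hGle z θ₀ hθ₀))
  · rw [lintegral_add_left hGm]
    exact (ENNReal.add_lt_top.2 ⟨hGfin, hGfin⟩).ne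
  · refine Eventually.of_forall fun z => ?_
    exact (((hDc z).sub continuous_const).enorm.tendsto θ₀).mono_left nhdsWithin_le_nhds

theorem mem_thetaBall_self {Θ : Set ℝ} {θ₀ r : ℝ} (h : θ₀ ∈ Θ) (hr : 0 ≤ r) :
    θ₀ ∈ thetaBall Θ θ₀ r := ⟨h, by simpa using hr⟩

theorem uIcc_subset_thetaBall {Θ : Set ℝ} {θ₀ δ : ℝ}
    (hseg : ∀ θ ∈ thetaBall Θ θ₀ δ, segment ℝ θ₀ θ ⊆ Θ) {θ : ℝ} (hθ : θ ∈ thetaBall Θ θ₀ δ) :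
    Set.uIcc θ₀ θ ⊆ thetaBall Θ θ₀ δ := fun c hc =>
  ⟨hseg θ hθ (by rwa [segment_eq_uIcc]), (Set.abs_sub_left_of_mem_uIcc hc).trans hθ.2⟩

/-- On the line, star-shapedness about `θ₀` means order-connectedness, so `Θ` itself need not be
measurable. -/
theorem measurableSet_thetaBall {Θ : Set ℝ} {θ₀ δ : ℝ}
    (hseg : ∀ θ ∈ thetaBall Θ θ₀ δ, segment ℝ θ₀ θ ⊆ Θ) : MeasurableSet (thetaBall Θ θ₀ δ) := by
  refine Set.OrdConnected.measurableSet (Set.ordConnected_def.2 fun a ha b hb c hc => ?_)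
  rcases le_total c θ₀ with h | h
  · exact uIcc_subset_thetaBall hseg ha (Set.mem_uIcc.2 (Or.inr ⟨hc.1, h⟩))
  · exact uIcc_subset_thetaBall hseg hb (Set.mem_uIcc.2 (Or.inl ⟨h, hc.2⟩))

/-- The root depends on the data, so the linearization error must be controlled for all `θ` in the
ball at once. The gradient discrepancy integrated over the whole ball, `G`, does this. Its expected
sum over the sample is at most `2R√n κ`, and Markov at level `√n ε/2` gives `4Rκ/ε`. The linear term
uses the other half of `√n ε`. -/
theorem measure_pi_exists_root_le {p ℓ : ℕ} (μ : Measure (Data p)) [IsProbabilityMeasure μ]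
    {m : Moment p ℓ} (hθ : ∀ z γ, Differentiable ℝ fun θ => m z θ γ)
    (hc : Continuous fun q : Data p × ℝ × Nuis ℓ => gradTheta m q.1 q.2.1 q.2.2)
    {Θ : Set ℝ} {θ₀ R ε κ : ℝ} {h h₀ : Cov p → Nuis ℓ} (hh : Measurable h) (hh₀ : Measurable h₀)
    {n : ℕ} (hn : 0 < n) (hR : 0 < R) (hε : 0 < ε)
    (hseg : ∀ θ ∈ thetaBall Θ θ₀ (R / √n), segment ℝ θ₀ θ ⊆ Θ)
    (hκ : ∀ θ ∈ thetaBall Θ θ₀ (R / √n),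
      ∫⁻ z, ‖gradTheta m z θ (h z.2.2) - gradTheta m z θ₀ (h₀ z.2.2)‖ₑ ∂μ ≤ ENNReal.ofReal κ) :
    Measure.pi (fun _ : Fin n => μ) {z | ∃ θ ∈ thetaBall Θ θ₀ (R / √n),
      ∑ t, m (z t) θ (h (z t).2.2) = 0 ∧ ε < |(∑ t, m (z t) θ₀ (h (z t).2.2)) / √n|} ≤
      ENNReal.ofReal (4 * R * κ / ε) + Measure.pi (fun _ : Fin n => μ)
        {z | ε / (2 * R) * n < |∑ t, gradTheta m (z t) θ₀ (h₀ (z t).2.2)|} := by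
  have hn0 : (0 : ℝ) < n := by exact_mod_cast hn
  have hs : 0 < √(n : ℝ) := Real.sqrt_pos.2 hn0
  have hss : √(n : ℝ) * √n = n := Real.mul_self_sqrt hn0.le
  set I := thetaBall Θ θ₀ (R / √n) with hI
  have hvol : volume I ≤ ENNReal.ofReal (2 * (R / √n)) := by
    have : I ⊆ Metric.closedBall θ₀ (R / √n) := fun θ hθ => by
      rw [Metric.mem_closedBall, Real.dist_eq]; exact hθ.2
    exact (measure_mono this).trans (by rw [Real.volume_closedBall])
  have hx : Measurable fun z : Data p => z.2.2 := by fun_prop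
  have hc0 : Measurable fun z : Data p => gradTheta m z θ₀ (h₀ z.2.2) :=
    hc.measurable.comp (measurable_id.prodMk (measurable_const.prodMk (hh₀.comp hx)))
  have hDm : Measurable fun q : Data p × ℝ =>
      ‖gradTheta m q.1 q.2 (h q.1.2.2) - gradTheta m q.1 θ₀ (h₀ q.1.2.2)‖ₑ :=
    ((hc.measurable.comp (measurable_fst.prodMk (measurable_snd.prodMk
      ((hh.comp hx).comp measurable_fst)))).sub (hc0.comp measurable_fst)).enorm
  set G : Data p → ℝ≥0∞ := fun z =>
    ∫⁻ θ in I, ‖gradTheta m z θ (h z.2.2) - gradTheta m z θ₀ (h₀ z.2.2)‖ₑ with hG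
  have hGm : Measurable G := hDm.lintegral_prod_right'
  have hGint : ∫⁻ z, G z ∂μ ≤ ENNReal.ofReal (2 * (R / √n) * κ) := by
    rw [hG, lintegral_lintegral_swap hDm.aemeasurable]
    refine (setLIntegral_mono' (measurableSet_thetaBall hseg) hκ).trans ?_
    rw [setLIntegral_const, ENNReal.ofReal_mul (by positivity), mul_comm]
    gcongr
  have hHm : Measurable fun z : Fin n → Data p => ∑ t, G (z t) :=
    Finset.measurable_sum _ fun t _ => hGm.comp (measurable_pi_apply t)
  have hHint : ∫⁻ z, ∑ t, G (z t) ∂(Measure.pi fun _ : Fin n => μ) ≤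
      ENNReal.ofReal (n * (2 * (R / √n) * κ)) := by
    rw [lintegral_finsetSum (f := fun (t : Fin n) (z : Fin n → Data p) => G (z t)) _
      fun t _ => hGm.comp (measurable_pi_apply t)]
    have : ∀ t : Fin n, ∫⁻ z, G (z t) ∂(Measure.pi fun _ : Fin n => μ) = ∫⁻ z, G z ∂μ := fun t =>
      (measurePreserving_eval (fun _ : Fin n => μ) t).lintegral_comp hGm
    simp only [this, Finset.sum_const, Finset.card_univ, Fintype.card_fin, nsmul_eq_mul]
    rw [ENNReal.ofReal_mul hn0.le, ENNReal.ofReal_natCast]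
    gcongr
  have hmark : Measure.pi (fun _ : Fin n => μ)
      {z | ENNReal.ofReal (√n * ε / 2) ≤ ∑ t, G (z t)} ≤ ENNReal.ofReal (4 * R * κ / ε) := by
    have hpos : 0 < √(n : ℝ) * ε / 2 := by positivity
    refine (meas_ge_le_lintegral_div hHm.aemeasurable (by simpa using hpos)
      ENNReal.ofReal_ne_top).trans ?_
    refine (ENNReal.div_le_div_right hHint _).trans ?_
    rw [← ENNReal.ofReal_div_of_pos hpos]
    refine ENNReal.ofReal_le_ofReal (le_of_eq ?_)
    field_simp
    linear_combination (-4 * κ) * hss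
  refine le_trans (measure_mono ?_) ((measure_union_le _ _).trans (add_le_add_left hmark _))
  rintro z ⟨θ, hθI, hroot, hgt⟩
  by_cases hz1 : ENNReal.ofReal (√n * ε / 2) ≤ ∑ t, G (z t)
  · exact Or.inl hz1
  right
  show ε / (2 * R) * n < |∑ t, gradTheta m (z t) θ₀ (h₀ (z t).2.2)|
  by_contra! hz2
  have hpt : ∀ t, ‖m (z t) θ (h (z t).2.2) - m (z t) θ₀ (h (z t).2.2) -
      (θ - θ₀) * gradTheta m (z t) θ₀ (h₀ (z t).2.2)‖ₑ ≤ G (z t) := by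
    intro t
    have hd : ∀ s, HasDerivAt (fun s => m (z t) s (h (z t).2.2) -
        s * gradTheta m (z t) θ₀ (h₀ (z t).2.2))
        (gradTheta m (z t) s (h (z t).2.2) - gradTheta m (z t) θ₀ (h₀ (z t).2.2)) s := by
      intro s
      have h1 := ((hasDerivAt_id s).mul_const (gradTheta m (z t) θ₀ (h₀ (z t).2.2)))
      rw [one_mul] at h1
      exact (hθ (z t) (h (z t).2.2) s).hasDerivAt.sub h1
    have h2 := enorm_sub_le_lintegral_of_hasDerivAt hd θ₀ θ
    have h3 := h2.trans (lintegral_mono_set (uIcc_subset_thetaBall hseg hθI))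
    rwa [show ∀ a b c : ℝ, a - θ * c - (b - θ₀ * c) = a - b - (θ - θ₀) * c from
      fun a b c => by ring] at h3
  have hsum : ‖∑ t, (m (z t) θ (h (z t).2.2) - m (z t) θ₀ (h (z t).2.2) -
      (θ - θ₀) * gradTheta m (z t) θ₀ (h₀ (z t).2.2))‖ₑ < ENNReal.ofReal (√n * ε / 2) :=
    ((enorm_sum_le _ _).trans (Finset.sum_le_sum fun t _ => hpt t)).trans_lt (not_le.1 hz1)
  rw [Finset.sum_sub_distrib, Finset.sum_sub_distrib, hroot, ← Finset.mul_sum, ← ofReal_norm,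
    ENNReal.ofReal_lt_ofReal_iff (by positivity), Real.norm_eq_abs] at hsum
  set A := ∑ t, m (z t) θ₀ (h (z t).2.2)
  set B := ∑ t, gradTheta m (z t) θ₀ (h₀ (z t).2.2)
  have hB : |(θ - θ₀) * B| ≤ √n * ε / 2 := by
    rw [abs_mul]
    calc |θ - θ₀| * |B| ≤ R / √n * (ε / (2 * R) * n) :=
          mul_le_mul hθI.2 hz2 (abs_nonneg _) (by positivity)
      _ = √n * ε / 2 := by
          field_simp
          linear_combination (-1) * hss
  have hA : |A| < √n * ε := by
    have := abs_sub_le A (-((θ - θ₀) * B)) 0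
    have e1 : |A - -((θ - θ₀) * B)| = |0 - A - (θ - θ₀) * B| := by
      rw [← abs_neg]; congr 1; ring
    rw [e1, sub_zero, sub_zero, abs_neg] at this
    linarith
  rw [abs_div, abs_of_pos hs, lt_div_iff₀ hs] at hgt
  linarith

/-! ### Conditioning on the auxiliary sample -/

/-- Markov's inequality for slice measures. `B` will involve the second-stage estimator, which need
not be measurable; hence the measurable hull. -/
theorem measure_lt_measure_slice_le {α β : Type*} [MeasurableSpace α] [MeasurableSpace β]
    (μ : Measure α) (ν : Measure β) [SFinite μ] [SFinite ν] (B : Set (α × β)) {ε : ℝ≥0∞}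
    (hε : ε ≠ 0) (hε' : ε ≠ ∞) :
    ν {y | ε < μ {x | (x, y) ∈ B}} ≤ (μ.prod ν) B / ε := by
  rw [← measure_toMeasurable B]
  set T := toMeasurable (μ.prod ν) B
  have hT : MeasurableSet T := measurableSet_toMeasurable _ _
  rw [Measure.prod_apply_symm hT]
  refine le_trans (measure_mono ?_)
    (meas_ge_le_lintegral_div (measurable_measure_prodMk_right hT).aemeasurable hε hε')
  intro y hy
  have hsub : {x | (x, y) ∈ B} ⊆ (fun x => (x, y)) ⁻¹' T := fun x hx => subset_toMeasurable _ B hx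
  exact (le_of_lt hy).trans (measure_mono hsub)

theorem measurable_errMoment_integrand {p ℓ : ℕ} {h h₀ : Cov p → Nuis ℓ} (hh : Measurable h)
    (hh₀ : Measurable h₀) (c : ℕ) (α : Fin ℓ → ℕ) :
    Measurable fun z : Data p => ∏ i, ‖h z.2.2 i - h₀ z.2.2 i‖ₑ ^ (c * α i) := by
  fun_prop

theorem errMoment_two_le {p ℓ : ℕ} (μ : Measure (Data p)) [IsProbabilityMeasure μ]
    {h h₀ : Cov p → Nuis ℓ} (hh : Measurable h) (hh₀ : Measurable h₀) (α : Fin ℓ → ℕ) :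
    errMoment μ h₀ h 2 α ≤ errMoment μ h₀ h 4 α ^ (1 / 2 : ℝ) := by
  have := ENNReal.lintegral_mul_le_Lp_mul_Lq μ Real.HolderConjugate.two_two
    (measurable_errMoment_integrand hh hh₀ 2 α).aemeasurable
    (aemeasurable_const (b := (1 : ℝ≥0∞)))
  simp only [Pi.mul_apply, mul_one, ENNReal.rpow_ofNat, ENNReal.one_rpow, lintegral_const,
    measure_univ, one_pow] at this
  refine this.trans (le_of_eq ?_)
  unfold errMoment
  congr 1
  refine lintegral_congr fun z => ?_
  rw [← Finset.prod_pow]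
  refine Finset.prod_congr rfl fun i _ => ?_
  rw [← pow_mul]
  congr 1
  ring

/-- For `α ∈ S` the fourth-power consistency condition dominates by Cauchy–Schwarz; for `α ∉ S` the
rate condition is stronger, as its factor `√n` is at least 1. -/
theorem tendstoZeroInProb_errMoment_two {p ℓ : ℕ} {μ : Measure (Data p)} [IsProbabilityMeasure μ]
    {Θ : Set ℝ} {𝓗 : Set (Cov p → Nuis ℓ)} {m : Moment p ℓ} {S : Finset (Fin ℓ → ℕ)}
    {hHat : FirstStage p ℓ} {θ₀ : ℝ} {h₀ : Cov p → Nuis ℓ} (hh₀ : Measurable h₀)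
    (hfirst : IsFirstStage 𝓗 hHat)
    (H : MainAssumptionsExceptNondegeneracy μ Θ 𝓗 m S hHat θ₀ h₀) {α : Fin ℓ → ℕ}
    (hα : α ≠ 0) (hdeg : deg α ≤ maxDeg S + 1) :
    TendstoZeroInProb μ fun n D => errMoment μ h₀ (hHat n D) 2 α := by
  intro ε hε
  by_cases hαS : α ∈ S
  · refine tendsto_of_tendsto_of_tendsto_of_le_of_le tendsto_const_nhds
      (H.consistency α hαS hα (ε ^ (2 : ℝ)) (by positivity)) (fun _ => zero_le) fun n => ?_
    refine measure_mono fun D hD => ?_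
    have hm : Measurable (hHat n D) := (hfirst.measurable n).comp measurable_prodMk_left
    have h1 : ε < errMoment μ h₀ (hHat n D) 4 α ^ (1 / 2 : ℝ) :=
      lt_of_lt_of_le hD (errMoment_two_le μ hm hh₀ α)
    have h2 := ENNReal.rpow_lt_rpow h1 (show (0 : ℝ) < 2 by norm_num)
    rw [← ENNReal.rpow_mul] at h2
    norm_num at h2
    simpa using h2
  · refine tendsto_of_tendsto_of_tendsto_of_le_of_le' tendsto_const_nhds
      (H.rate α hdeg hαS hα (ε ^ (1 / 2 : ℝ)) (by positivity))
      (Eventually.of_forall fun _ => zero_le) ?_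
    filter_upwards [eventually_ge_atTop 1] with n hn
    refine measure_mono fun D hD => ?_
    have hn1 : (1 : ℝ≥0∞) ≤ (n : ℝ≥0∞) ^ (1 / 2 : ℝ) :=
      ENNReal.one_le_rpow (by exact_mod_cast hn) (by norm_num)
    refine lt_of_lt_of_le (ENNReal.rpow_lt_rpow hD (by norm_num)) ?_
    exact le_mul_of_one_le_left' hn1

theorem deg_ne_zero_iff {ℓ : ℕ} {α : Fin ℓ → ℕ} : 1 ≤ deg α ↔ α ≠ 0 := by
  rw [Nat.one_le_iff_ne_zero, not_iff_not, deg, Finset.sum_eq_zero_iff]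
  simp [funext_iff]

theorem finite_setOf_deg_le (ℓ K : ℕ) : {α : Fin ℓ → ℕ | deg α ≤ K}.Finite := by
  refine ((Fintype.piFinset fun _ : Fin ℓ => Finset.range (K + 1)).finite_toSet).subset ?_
  intro α hα
  simp only [Finset.mem_coe, Fintype.mem_piFinset, Finset.mem_range]
  intro i
  have : α i ≤ deg α := Finset.single_le_sum (fun _ _ => Nat.zero_le _) (Finset.mem_univ i)
  have : deg α ≤ K := hα
  omega

/-- Sample splitting lets `ĥ` be frozen: some realization `D` of the auxiliary sample is good both
for the nuisance errors and for the conditional probability of a nearby root. `R` is fixed before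
`τ`, because `τ` will later be chosen in terms of `R`. -/
theorem exists_eventually_good_first_stage {p ℓ : ℕ} {μ : Measure (Data p)}
    [IsProbabilityMeasure μ] {Θ : Set ℝ} {𝓗 : Set (Cov p → Nuis ℓ)} {m : Moment p ℓ}
    {S : Finset (Fin ℓ → ℕ)} {hHat : FirstStage p ℓ} {θHat : SecondStage p} {θ₀ : ℝ}
    {h₀ : Cov p → Nuis ℓ} (hh₀ : Measurable h₀) (hfirst : IsFirstStage 𝓗 hHat)
    (hsplit : IsSampleSplitting μ Θ m hHat θHat)
    (H : MainAssumptionsExceptNondegeneracy μ Θ 𝓗 m S hHat θ₀ h₀)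
    (hroot : IsRootNConsistent μ θ₀ θHat) {ε : ℝ} (hε : 0 < ε) :
    ∃ R : ℝ, 0 < R ∧ ∀ τ : ℝ, 0 < τ → ∀ᶠ n : ℕ in atTop, ∃ h ∈ 𝓗, Measurable h ∧
      (∀ α : Fin ℓ → ℕ, 1 ≤ deg α → deg α ≤ maxDeg S + 1 →
        errMoment μ h₀ h 2 α ≤ ENNReal.ofReal τ) ∧
      Measure.pi (fun _ : Fin n => μ) {z | ¬ ∃ θ ∈ thetaBall Θ θ₀ (R / √n),
        ∑ t, m (z t) θ (h (z t).2.2) = 0} ≤ ENNReal.ofReal ε := by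
  obtain ⟨R, hR, N, hN⟩ := hroot (ε * (1 / 8)) (by positivity)
  refine ⟨R, hR, fun τ hτ => ?_⟩
  have hfin := finite_setOf_deg_le ℓ (maxDeg S + 1)
  set A : Finset (Fin ℓ → ℕ) := hfin.toFinset.filter fun α => α ≠ 0 with hA
  have hmemA : ∀ α, α ∈ A ↔ deg α ≤ maxDeg S + 1 ∧ α ≠ 0 := fun α => by simp [hA]
  have hsum : Tendsto (fun n => ∑ α ∈ A, sampleLaw μ n
      {D | ENNReal.ofReal τ < errMoment μ h₀ (hHat n D) 2 α}) atTop (𝓝 0) := by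
    rw [← Finset.sum_const_zero (s := A)]
    exact tendsto_finsetSum _ fun α hα => tendstoZeroInProb_errMoment_two hh₀ hfirst H
      ((hmemA α).1 hα).2 ((hmemA α).1 hα).1 _ (by simpa using hτ)
  have hq : (0 : ℝ≥0∞) < ENNReal.ofReal (ε * (1 / 8)) := by simpa using hε
  filter_upwards [hsum.eventually_lt_const (show (0 : ℝ≥0∞) < 1 / 4 by norm_num),
    hsplit.eventually_lt_const hq, eventually_gt_atTop N, eventually_gt_atTop 0]
    with n hn1 hn2 hn3 hn4
  have hn0 : (0 : ℝ) < n := by exact_mod_cast hn4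
  have hs : 0 < √(n : ℝ) := Real.sqrt_pos.2 hn0
  have : IsProbabilityMeasure (sampleLaw μ n) := by unfold sampleLaw; infer_instance
  set B : Set ((Fin n → Data p) × (Fin n → Data p)) := {q | ¬ (θHat n q.1 q.2 ∈ Θ ∧
      (1 / (n : ℝ)) * ∑ t, m (q.1 t) (θHat n q.1 q.2) (hHat n q.2 (q.1 t).2.2) = 0)} ∪
      {q | R < |(θHat n q.1 q.2 - θ₀) / (1 / √(n : ℝ))|} with hB
  have hBle : splitLaw μ n B ≤ ENNReal.ofReal ε * (1 / 4) := by
    refine (measure_union_le _ _).trans ((add_le_add hn2.le (hN n hn3)).trans (le_of_eq ?_))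
    rw [← ENNReal.ofReal_add (by positivity) (by positivity), ← add_mul,
      show (ε + ε) * (1 / 8) = ε * (1 / 4) by ring, ENNReal.ofReal_mul hε.le]
    congr 1
    rw [ENNReal.ofReal_div_of_pos (by norm_num)]
    simp
  have hε0 : ENNReal.ofReal ε ≠ 0 := by simpa using hε
  have hslice : sampleLaw μ n {D | ENNReal.ofReal ε < sampleLaw μ n {z | (z, D) ∈ B}} ≤ 1 / 4 := by
    refine (measure_lt_measure_slice_le (sampleLaw μ n) (sampleLaw μ n) B hε0
      ENNReal.ofReal_ne_top).trans ?_
    refine ENNReal.div_le_of_le_mul ?_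
    rw [mul_comm]
    exact hBle
  -- Both families of bad `D` have probability at most `1/4`, so a good `D` exists.
  have hbad : sampleLaw μ n ({D | ENNReal.ofReal ε < sampleLaw μ n {z | (z, D) ∈ B}} ∪
      ⋃ α ∈ A, {D | ENNReal.ofReal τ < errMoment μ h₀ (hHat n D) 2 α}) < 1 := by
    refine (measure_union_le _ _).trans_lt ?_
    refine (add_le_add hslice ((measure_biUnion_finset_le _ _).trans hn1.le)).trans_lt ?_
    rw [← ENNReal.toReal_lt_toReal (by simp) (by simp)]
    simp only [one_div]
    rw [ENNReal.toReal_add (by simp) (by simp)]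
    simp only [ENNReal.toReal_inv, ENNReal.toReal_ofNat, ENNReal.toReal_one]
    norm_num
  obtain ⟨D, hD⟩ : ∃ D, D ∉ ({D | ENNReal.ofReal ε < sampleLaw μ n {z | (z, D) ∈ B}} ∪
      ⋃ α ∈ A, {D | ENNReal.ofReal τ < errMoment μ h₀ (hHat n D) 2 α}) := by
    by_contra! hall
    rw [Set.eq_univ_of_forall hall, measure_univ] at hbad
    exact lt_irrefl _ hbad
  simp only [Set.mem_union, Set.mem_iUnion, Set.mem_ofPred_eq, not_or, not_lt, not_exists] at hD
  refine ⟨hHat n D, hfirst.mem n D, (hfirst.measurable n).comp measurable_prodMk_left,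
    fun α h1 h2 => hD.2 α ((hmemA α).2 ⟨h2, deg_ne_zero_iff.1 h1⟩), ?_⟩
  refine le_trans (measure_mono fun z hz => ?_) hD.1
  by_contra hzB
  simp only [hB, Set.mem_ofPred_eq, Set.mem_union, not_or, not_not, not_lt] at hzB
  obtain ⟨⟨h1, h2⟩, h3⟩ := hzB
  refine hz ⟨θHat n z D, ⟨h1, ?_⟩, ?_⟩
  · rw [div_div_eq_mul_div, div_one, abs_mul, abs_of_pos hs] at h3
    rw [le_div_iff₀ hs]; exact h3
  · exact (mul_eq_zero.1 h2).resolve_left (by positivity)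

/-! ### Degeneracy forces the moment to vanish -/

theorem Smoothness.differentiable_nuis {p ℓ : ℕ} {m : Moment p ℓ} {k : ℕ} (H : Smoothness m k)
    (z : Data p) (θ : ℝ) : Differentiable ℝ (m z θ) := by
  rcases Nat.eq_zero_or_pos k with rfl | hk
  -- For `k = 0`, `contDiff` gives only continuity; differentiability comes from `gamma`, the zeroth
  -- iterated derivative being `m` itself up to an isometry.
  · have h1 := H.gamma z θ
    rw [iteratedFDeriv_zero_eq_comp] at h1
    exact ((continuousMultilinearCurryFin0 ℝ (Nuis ℓ) ℝ).symm.comp_differentiable_iff).1 h1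
  · have h1 : ContDiff ℝ k (m z θ) :=
      H.contDiff.comp (contDiff_const.prodMk (contDiff_const.prodMk contDiff_id))
    exact h1.differentiable (by exact_mod_cast hk.ne')

theorem lintegral_enorm_sub_sq_le {p ℓ : ℕ} (μ : Measure (Data p)) {h h₀ : Cov p → Nuis ℓ}
    (hh : Measurable h) (hh₀ : Measurable h₀) {τ : ℝ≥0∞}
    (H : ∀ α : Fin ℓ → ℕ, deg α = 1 → errMoment μ h₀ h 2 α ≤ τ) :
    ∫⁻ z, ‖h z.2.2 - h₀ z.2.2‖ₑ ^ 2 ∂μ ≤ ℓ * τ := by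
  have h1 : ∀ z : Data p, ‖h z.2.2 - h₀ z.2.2‖ₑ ^ 2 =
      ∑ i, ‖h z.2.2 i - h₀ z.2.2 i‖ₑ ^ 2 := by
    intro z
    simp only [← ofReal_norm, ← ENNReal.ofReal_pow (norm_nonneg _)]
    rw [EuclideanSpace.norm_sq_eq, ENNReal.ofReal_sum_of_nonneg fun _ _ => sq_nonneg _]
    rfl
  have h2 : ∀ i, ∫⁻ z, ‖h z.2.2 i - h₀ z.2.2 i‖ₑ ^ 2 ∂μ ≤ τ := by
    intro i
    have h3 := H (Pi.single i 1) (by simp [deg])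
    refine le_trans (le_of_eq (lintegral_congr fun z => ?_)) h3
    rw [Finset.prod_eq_single i (fun j _ hj => by simp [hj]) (by simp)]
    simp
  simp only [h1]
  rw [lintegral_finsetSum _ fun i _ => by fun_prop]
  refine (Finset.sum_le_sum fun i _ => h2 i).trans ?_
  simp

/-- This keeps the whole segment from `h₀` to `h` in `nuisBall`, where the derivative bounds hold.
-/
theorem errMoment_segment_le {p ℓ : ℕ} (μ : Measure (Data p)) (h h₀ : Cov p → Nuis ℓ) (c : ℕ)
    (α : Fin ℓ → ℕ) {s : ℝ} (hs : s ∈ Set.Icc (0 : ℝ) 1) :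
    errMoment μ h₀ (h₀ + s • (h - h₀)) c α ≤ errMoment μ h₀ h c α := by
  refine lintegral_mono fun z => Finset.prod_le_prod' fun i _ => ?_
  gcongr
  simp only [Pi.add_apply, Pi.smul_apply, Pi.sub_apply, PiLp.add_apply, PiLp.smul_apply,
    PiLp.sub_apply, add_sub_cancel_left, smul_eq_mul, enorm_mul]
  refine mul_le_of_le_one_left' ?_
  rw [← ofReal_norm, Real.norm_eq_abs, abs_of_nonneg hs.1]
  exact ENNReal.ofReal_le_one.2 hs.2

theorem eventually_rpow_half_mul_le {C : ℝ≥0∞} (hC : C ≠ ∞) (ℓ : ℕ) {κ : ℝ} (hκ : 0 < κ) :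
    ∀ᶠ τ : ℝ in 𝓝[>] 0,
      C ^ (1 / 2 : ℝ) * (ℓ * ENNReal.ofReal τ) ^ (1 / 2 : ℝ) ≤ ENNReal.ofReal κ := by
  have h1 : Tendsto (fun τ : ℝ => ENNReal.ofReal τ) (𝓝[>] 0) (𝓝 0) := by
    have := (ENNReal.continuous_ofReal.tendsto 0).mono_left (nhdsWithin_le_nhds (s := Set.Ioi 0))
    simpa using this
  have h2 := ENNReal.Tendsto.const_mul (a := (ℓ : ℝ≥0∞)) h1 (Or.inr (by simp))
  have h3 := (ENNReal.continuous_rpow_const (y := 1 / 2)).tendsto _ |>.comp h2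
  have h4 := ENNReal.Tendsto.const_mul (a := C ^ (1 / 2 : ℝ)) h3
    (Or.inr (ENNReal.rpow_ne_top_of_nonneg (by norm_num) hC))
  have h5 : C ^ (1 / 2 : ℝ) * ((ℓ : ℝ≥0∞) * 0) ^ (1 / 2 : ℝ) = 0 := by norm_num
  rw [h5] at h4
  exact (h4.eventually_lt_const (show (0 : ℝ≥0∞) < ENNReal.ofReal κ by simpa using hκ)).mono
    fun τ h => h.le

/-- With a vanishing mean gradient, a root at distance `O(1/√n)` leaves no room for fluctuations of
order `√n` in the sum at `θ₀`, so the moment cannot be random. -/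
theorem moment_ae_eq_zero {p ℓ : ℕ} {μ : Measure (Data p)} [IsProbabilityMeasure μ]
    {Θ : Set ℝ} (hΘ_seg : LocallyStarShaped Θ) {𝓗 : Set (Cov p → Nuis ℓ)}
    (h𝓗_meas : ∀ h ∈ 𝓗, Measurable h)
    (h𝓗_seg : L2LocallyStarShaped (μ.map fun z => z.2.2) 𝓗) {m : Moment p ℓ}
    {S : Finset (Fin ℓ → ℕ)} {hHat : FirstStage p ℓ} {θHat : SecondStage p} {θ₀ : ℝ}
    (hθ₀ : θ₀ ∈ Θ) {h₀ : Cov p → Nuis ℓ} (hh₀ : h₀ ∈ 𝓗) (hfirst : IsFirstStage 𝓗 hHat)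
    (hsplit : IsSampleSplitting μ Θ m hHat θHat)
    (H : MainAssumptionsExceptNondegeneracy μ Θ 𝓗 m S hHat θ₀ h₀)
    (hgrad : ∫ z, gradTheta m z θ₀ (h₀ z.2.2) ∂μ = 0)
    (hroot : IsRootNConsistent μ θ₀ θHat) :
    ∀ᵐ z ∂μ, m z θ₀ (h₀ z.2.2) = 0 := by
  have hh₀m := h𝓗_meas h₀ hh₀
  have hx : Measurable fun z : Data p => z.2.2 := by fun_prop
  have hmc : Continuous fun q : Data p × ℝ × Nuis ℓ => m q.1 q.2.1 q.2.2 :=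
    H.smoothness.contDiff.continuous
  have hgc := H.smoothness.theta_continuous
  have hmm : ∀ {h : Cov p → Nuis ℓ} (θ : ℝ), Measurable h →
      Measurable fun z : Data p => m z θ (h z.2.2) := fun {h} θ hh =>
    hmc.measurable.comp (measurable_id.prodMk (measurable_const.prodMk (hh.comp hx)))
  have hgm : ∀ θ : ℝ, Measurable fun z : Data p => gradTheta m z θ (h₀ z.2.2) := fun θ =>
    hgc.measurable.comp (measurable_id.prodMk (measurable_const.prodMk (hh₀m.comp hx)))
  obtain ⟨r, hr, hreg⟩ := H.regularity
  obtain ⟨ρΘ, hρΘ, hsegΘ⟩ := hΘ_seg θ₀ hθ₀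
  obtain ⟨ρ𝓗, hρ𝓗, hseg𝓗⟩ := h𝓗_seg h₀ hh₀
  have hθ₀r : θ₀ ∈ thetaBall Θ θ₀ r := mem_thetaBall_self hθ₀ hr.le
  have hgi : Integrable (fun z => gradTheta m z θ₀ (h₀ z.2.2)) μ := by
    refine ⟨(hgm θ₀).aestronglyMeasurable, lt_of_le_of_lt (lintegral_mono fun z => ?_)
      hreg.theta_dominated⟩
    exact le_iSup₂ (f := fun θ (_ : θ ∈ thetaBall Θ θ₀ r) => ‖gradTheta m z θ (h₀ z.2.2)‖ₑ) θ₀ hθ₀r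
  have hgcont := tendsto_lintegral_enorm_sub_of_lintegral_iSup_lt_top
    (D := fun z θ => gradTheta m z θ (h₀ z.2.2)) hgm
    (fun z => hgc.comp (f := fun θ : ℝ => (z, θ, h₀ z.2.2)) (by fun_prop)) hθ₀r hreg.theta_dominated
  set C₁ := ⨆ h ∈ nuisBall μ 𝓗 h₀ (maxDeg S) r,
      ∫⁻ z, ⨆ θ ∈ thetaBall Θ θ₀ r, ‖fderiv ℝ (gradTheta m z θ) (h z.2.2)‖ₑ ^ 2 ∂μ with hC₁
  set C₂ := ⨆ θ ∈ ({θ₀} : Set ℝ), ⨆ h ∈ nuisBall μ 𝓗 h₀ (maxDeg S) r,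
      ∫⁻ z, ‖fderiv ℝ (m z θ) (h z.2.2)‖ₑ ^ 2 ∂μ with hC₂
  have hC₁fin : C₁ ≠ ∞ := hreg.gamma_theta_derivs.ne
  have hC₂fin : C₂ ≠ ∞ :=
    (hreg.gamma_deriv {θ₀} (Set.singleton_subset_iff.2 hθ₀) isCompact_singleton).ne
  have hconst : ∃ c : ℝ, (fun z => m z θ₀ (h₀ z.2.2)) =ᵐ[μ] fun _ => c := by
    refine ae_eq_const_of_frequently_measure_pi_abs_sum_gt_le μ (hmm θ₀ hh₀m) fun ε hε => ?_
    obtain ⟨R, hR, hgood⟩ := exists_eventually_good_first_stage hh₀m hfirst hsplit H hroot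
      (show 0 < ε * (1 / 4) by positivity)
    -- The gradient discrepancy will be at most `2κ` (one `κ` for moving `h`, one for moving `θ`),
    -- and `4R · 2κ/ε = ε/4`.
    set κ : ℝ := ε ^ 2 / (32 * R) with hκ
    have hκ0 : 0 < κ := by positivity
    obtain ⟨δ, hδ, hδκ⟩ : ∃ δ : ℝ, 0 < δ ∧ ∀ θ ∈ thetaBall Θ θ₀ r, |θ - θ₀| < δ →
        ∫⁻ z, ‖gradTheta m z θ (h₀ z.2.2) - gradTheta m z θ₀ (h₀ z.2.2)‖ₑ ∂μ ≤
          ENNReal.ofReal κ := by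
      have h1 := hgcont.eventually_lt_const
        (show (0 : ℝ≥0∞) < ENNReal.ofReal κ by simpa using hκ0)
      rw [eventually_nhdsWithin_iff, Metric.eventually_nhds_iff] at h1
      obtain ⟨δ, hδ, h2⟩ := h1
      exact ⟨δ, hδ, fun θ hθ hlt => (h2 (by rwa [Real.dist_eq]) hθ).le⟩
    have hτex : ∀ᶠ τ : ℝ in 𝓝[>] 0, 0 < τ ∧ τ ≤ r ∧ ℓ * τ ≤ ρ𝓗 ∧
        C₁ ^ (1 / 2 : ℝ) * (ℓ * ENNReal.ofReal τ) ^ (1 / 2 : ℝ) ≤ ENNReal.ofReal κ ∧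
        C₂ ^ (1 / 2 : ℝ) * (ℓ * ENNReal.ofReal τ) ^ (1 / 2 : ℝ) ≤ ENNReal.ofReal ε := by
      have hlim : Tendsto (fun τ : ℝ => ℓ * τ) (𝓝[>] 0) (𝓝 0) := by
        have := ((continuous_const_mul (ℓ : ℝ)).tendsto 0).mono_left
          (nhdsWithin_le_nhds (s := Set.Ioi 0))
        simpa using this
      filter_upwards [Ioc_mem_nhdsGT hr, hlim.eventually_le_const hρ𝓗,
        eventually_rpow_half_mul_le hC₁fin ℓ hκ0, eventually_rpow_half_mul_le hC₂fin ℓ hε]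
        with τ h1 h2 h3 h4
      exact ⟨h1.1, h1.2, h2, h3, h4⟩
    obtain ⟨τ, hτ, hτr, hτρ, hτ1, hτ2⟩ := hτex.exists
    have hRn : Tendsto (fun n : ℕ => R / √(n : ℝ)) atTop (𝓝 0) :=
      tendsto_const_nhds.div_atTop (Real.tendsto_sqrt_atTop.comp tendsto_natCast_atTop_atTop)
    have hlln := tendsto_measure_pi_abs_sum_gt μ (hgm θ₀) hgi hgrad
      (show 0 < ε / (2 * R) by positivity)
    refine Eventually.frequently ?_
    filter_upwards [hgood τ hτ, eventually_gt_atTop 0, hRn.eventually_lt_const hδ,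
      hRn.eventually_lt_const hr, hRn.eventually_lt_const hρΘ,
      hlln.eventually_lt_const (show (0 : ℝ≥0∞) < ENNReal.ofReal (ε * (1 / 4)) by simpa using hε)]
      with n ⟨h, hh, hhm, herr, hbad⟩ hn hnδ hnr hnρ hnlln
    have hL2 : ∫⁻ z, ‖h z.2.2 - h₀ z.2.2‖ₑ ^ 2 ∂μ ≤ ℓ * ENNReal.ofReal τ :=
      lintegral_enorm_sub_sq_le μ hhm hh₀m fun α hα => herr α hα.ge (by omega)
    have hsegh : segment ℝ h₀ h ⊆ 𝓗 := by
      refine hseg𝓗 h hh ?_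
      rw [lintegral_map (by fun_prop) hx]
      refine hL2.trans ?_
      rw [← ENNReal.ofReal_natCast, ← ENNReal.ofReal_mul (Nat.cast_nonneg _)]
      exact ENNReal.ofReal_le_ofReal hτρ
    have hball : ∀ s ∈ Set.Icc (0 : ℝ) 1,
        h₀ + s • (h - h₀) ∈ nuisBall μ 𝓗 h₀ (maxDeg S) r := by
      intro s hs
      refine ⟨hsegh ?_, fun α h1 h2 => (errMoment_segment_le μ h h₀ 2 α hs).trans
        ((herr α h1 h2).trans (ENNReal.ofReal_le_ofReal hτr))⟩
      rw [segment_eq_image']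
      exact ⟨s, hs, rfl⟩
    have hmdiff : ∫⁻ z, ‖m z θ₀ (h z.2.2) - m z θ₀ (h₀ z.2.2)‖ₑ ∂μ ≤ ENNReal.ofReal ε := by
      refine (lintegral_enorm_sub_le μ (F := fun z γ => m z θ₀ γ) (C := C₂)
        (hmc.comp (by fun_prop : Continuous fun q : Data p × Nuis ℓ => (q.1, θ₀, q.2)))
        (fun z => H.smoothness.differentiable_nuis z θ₀) hhm hh₀m fun s hs => ?_).trans
        (le_trans (by gcongr) hτ2)
      refine le_trans ?_ (le_iSup₂ (f := fun θ (_ : θ ∈ ({θ₀} : Set ℝ)) =>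
        ⨆ h ∈ nuisBall μ 𝓗 h₀ (maxDeg S) r,
          ∫⁻ z, ‖fderiv ℝ (m z θ) (h z.2.2)‖ₑ ^ 2 ∂μ) θ₀ rfl)
      exact le_iSup₂ (f := fun h (_ : h ∈ nuisBall μ 𝓗 h₀ (maxDeg S) r) =>
        ∫⁻ z, ‖fderiv ℝ (m z θ₀) (h z.2.2)‖ₑ ^ 2 ∂μ) _ (hball s hs)
    have hgdiff : ∀ θ ∈ thetaBall Θ θ₀ (R / √n),
        ∫⁻ z, ‖gradTheta m z θ (h z.2.2) - gradTheta m z θ₀ (h₀ z.2.2)‖ₑ ∂μ ≤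
          ENNReal.ofReal (2 * κ) := by
      intro θ hθ
      have hθr : θ ∈ thetaBall Θ θ₀ r := ⟨hθ.1, hθ.2.trans hnr.le⟩
      have h1 : ∫⁻ z, ‖gradTheta m z θ (h z.2.2) - gradTheta m z θ (h₀ z.2.2)‖ₑ ∂μ ≤
          ENNReal.ofReal κ := by
        refine (lintegral_enorm_sub_le μ (F := fun z γ => gradTheta m z θ γ) (C := C₁)
          (hgc.comp (by fun_prop : Continuous fun q : Data p × Nuis ℓ => (q.1, θ, q.2)))
          (fun z => H.smoothness.gamma_theta z θ) hhm hh₀m fun s hs => ?_).trans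
          (le_trans (by gcongr) hτ1)
        refine le_trans (lintegral_mono fun z => ?_)
          (le_iSup₂ (f := fun h (_ : h ∈ nuisBall μ 𝓗 h₀ (maxDeg S) r) =>
            ∫⁻ z, ⨆ θ ∈ thetaBall Θ θ₀ r, ‖fderiv ℝ (gradTheta m z θ) (h z.2.2)‖ₑ ^ 2 ∂μ)
            _ (hball s hs))
        exact le_iSup₂ (f := fun θ (_ : θ ∈ thetaBall Θ θ₀ r) =>
          ‖fderiv ℝ (gradTheta m z θ) ((h₀ + s • (h - h₀)) z.2.2)‖ₑ ^ 2) θ hθr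
      have h2 := hδκ θ hθr (hθ.2.trans_lt hnδ)
      have hm1 : Measurable fun z : Data p => gradTheta m z θ (h z.2.2) :=
        hgc.measurable.comp (measurable_id.prodMk (measurable_const.prodMk (hhm.comp hx)))
      calc _ ≤ ∫⁻ z, (‖gradTheta m z θ (h z.2.2) - gradTheta m z θ (h₀ z.2.2)‖ₑ +
            ‖gradTheta m z θ (h₀ z.2.2) - gradTheta m z θ₀ (h₀ z.2.2)‖ₑ) ∂μ := by
            refine lintegral_mono fun z => ?_
            refine le_trans (le_of_eq ?_) (enorm_add_le _ _)
            rw [sub_add_sub_cancel]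
        _ ≤ ENNReal.ofReal κ + ENNReal.ofReal κ := by
            have hm2 : Measurable fun z : Data p =>
                ‖gradTheta m z θ (h z.2.2) - gradTheta m z θ (h₀ z.2.2)‖ₑ :=
              (hm1.sub (hgm θ)).enorm
            rw [lintegral_add_left hm2]
            exact add_le_add h1 h2
        _ = _ := by rw [← ENNReal.ofReal_add hκ0.le hκ0.le, two_mul]
    have hinc := measure_pi_exists_root_le μ H.smoothness.theta hgc hhm hh₀m hn hR hε
      (fun θ hθ => hsegΘ θ hθ.1 (hθ.2.trans hnρ.le)) hgdiff
    refine ⟨fun z => m z θ₀ (h z.2.2), hmm θ₀ hhm, hmdiff, ?_⟩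
    have hcover : {z : Fin n → Data p | ε < |(∑ t, m (z t) θ₀ (h (z t).2.2)) / √n|} ⊆
        {z | ¬ ∃ θ ∈ thetaBall Θ θ₀ (R / √n), ∑ t, m (z t) θ (h (z t).2.2) = 0} ∪
        {z | ∃ θ ∈ thetaBall Θ θ₀ (R / √n), ∑ t, m (z t) θ (h (z t).2.2) = 0 ∧
          ε < |(∑ t, m (z t) θ₀ (h (z t).2.2)) / √n|} := by
      intro z hz
      by_cases hex : ∃ θ ∈ thetaBall Θ θ₀ (R / √n), ∑ t, m (z t) θ (h (z t).2.2) = 0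
      · obtain ⟨θ, hθ, h0⟩ := hex
        exact Or.inr ⟨θ, hθ, h0, hz⟩
      · exact Or.inl hex
    -- Three contributions of `ε/4`: no nearby root, the linearization error, and failure of the law
    -- of large numbers.
    refine (measure_mono hcover).trans ((measure_union_le _ _).trans
      ((add_le_add hbad (hinc.trans (add_le_add_right hnlln.le _))).trans ?_))
    rw [← ENNReal.ofReal_add (by positivity) (by positivity),
      ← ENNReal.ofReal_add (by positivity) (by positivity)]
    refine ENNReal.ofReal_le_ofReal ?_
    have : 4 * R * (2 * κ) / ε = ε * (1 / 4) := by
      rw [hκ]; field_simp; norm_num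
    rw [this]
    linarith
  obtain ⟨c, hc⟩ := hconst
  have hint : ∫ z, m z θ₀ (h₀ z.2.2) ∂μ = 0 := by
    rw [← integral_condExp hx.comap_le, integral_congr_ae H.moment_condition.2]
    simp
  rw [integral_congr_ae hc] at hint
  have hc0 : c = 0 := by simpa using hint
  filter_upwards [hc] with z hz
  rw [hz, hc0]

/-! ### Full support of the noise -/

theorem measurable_plrData {p : ℕ} (θ₀ : ℝ) {f₀ g₀ : Cov p → ℝ} (hf : Measurable f₀)
    (hg : Measurable g₀) : Measurable (plrData θ₀ f₀ g₀) := by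
  unfold plrData
  fun_prop

/-- Given `x`, the noise values where `F` vanishes form a closed set of full conditional measure,
hence all of `ℝ²`; the noise-to-`(t, y)` map is onto. -/
theorem ae_forall_of_ae_plrLaw {p : ℕ} {P : Measure (Cov p × ℝ × ℝ)} [IsProbabilityMeasure P]
    (hsupport : ∀ᵐ x ∂P.fst, (P.condKernel x).support = Set.univ) {θ₀ : ℝ} {f₀ g₀ : Cov p → ℝ}
    (hf : Measurable f₀) (hg : Measurable g₀) {F : Data p → ℝ}
    (hFc : ∀ x, Continuous fun q : ℝ × ℝ => F (q.1, q.2, x))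
    (hF : ∀ᵐ z ∂plrLaw P θ₀ f₀ g₀, F z = 0) :
    ∀ᵐ x ∂P.fst, ∀ t y, F (t, y, x) = 0 := by
  have hd := measurable_plrData θ₀ hf hg
  have h1 : ∀ᵐ w ∂P, F (plrData θ₀ f₀ g₀ w) = 0 := ae_of_ae_map hd.aemeasurable hF
  rw [← P.disintegrate P.condKernel] at h1
  have h2 := Measure.ae_ae_of_ae_compProd h1
  filter_upwards [hsupport, h2] with x hx hx2 t y
  have hcl : IsClosed {e : ℝ × ℝ | F (plrData θ₀ f₀ g₀ (x, e)) = 0} := by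
    refine isClosed_eq ?_ continuous_const
    exact (hFc x).comp (f := fun e : ℝ × ℝ =>
      (g₀ x + e.2, θ₀ * (g₀ x + e.2) + f₀ x + e.1)) (by fun_prop)
  have hsub := Measure.support_subset_of_isClosed hcl hx2
  rw [hx] at hsub
  have h3 : F (plrData θ₀ f₀ g₀ (x, (y - θ₀ * t - f₀ x, t - g₀ x))) = 0 :=
    hsub (Set.mem_univ (y - θ₀ * t - f₀ x, t - g₀ x))
  rw [← h3]
  unfold plrData
  congr 1
  ext1
  · simp
  · ext1
    · simp
    · rfl

theorem map_plrLaw_covariate {p : ℕ} (P : Measure (Cov p × ℝ × ℝ)) (θ₀ : ℝ) {f₀ g₀ : Cov p → ℝ}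
    (hf : Measurable f₀) (hg : Measurable g₀) :
    (plrLaw P θ₀ f₀ g₀).map (fun z => z.2.2) = P.fst := by
  rw [plrLaw, Measure.map_map (by fun_prop) (measurable_plrData θ₀ hf hg)]
  rfl

/-! ### The contradiction between two parameter values. -/

theorem proposition1 {p ℓ : ℕ}
    (P : Measure (Cov p × ℝ × ℝ)) [IsProbabilityMeasure P]
    (hsupport : ∀ᵐ x ∂P.fst, (P.condKernel x).support = Set.univ)
    (Θ : Set ℝ) (hΘ : Θ.Nontrivial) (hΘ_seg : LocallyStarShaped Θ)
    (𝓗 : Set (Cov p → Nuis ℓ)) (h𝓗 : 𝓗.Nonempty) (h𝓗_meas : ∀ h ∈ 𝓗, Measurable h)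
    (h𝓗_seg : L2LocallyStarShaped P.fst 𝓗)
    (f g : ℝ → (Cov p → Nuis ℓ) → Cov p → ℝ)
    (hPLR : ∀ θ₀ ∈ Θ, ∀ h₀ ∈ 𝓗, IsPLR P (f θ₀ h₀) (g θ₀ h₀)) :
    ¬ ∃ m : Moment p ℓ, ∀ θ₀ ∈ Θ, ∀ h₀ ∈ 𝓗,
      ∃ (S : Finset (Fin ℓ → ℕ)) (hHat : FirstStage p ℓ) (θHat : SecondStage p),
        IsFirstStage 𝓗 hHat ∧
        IsSampleSplitting (plrLaw P θ₀ (f θ₀ h₀) (g θ₀ h₀)) Θ m hHat θHat ∧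
        MainAssumptionsExceptNondegeneracy (plrLaw P θ₀ (f θ₀ h₀) (g θ₀ h₀))
          Θ 𝓗 m S hHat θ₀ h₀ ∧
        ∫ z, gradTheta m z θ₀ (h₀ z.2.2) ∂(plrLaw P θ₀ (f θ₀ h₀) (g θ₀ h₀)) = 0 ∧
        IsRootNConsistent (plrLaw P θ₀ (f θ₀ h₀) (g θ₀ h₀)) θ₀ θHat := by

  rintro ⟨m, hm⟩
  obtain ⟨θ₀, hθ₀, θ₁, hθ₁, hne⟩ := hΘ
  obtain ⟨h₀, hh₀⟩ := h𝓗
  have hprob : ∀ θ ∈ Θ, IsProbabilityMeasure (plrLaw P θ (f θ h₀) (g θ h₀)) := fun θ hθ =>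
    Measure.isProbabilityMeasure_map (measurable_plrData θ (hPLR θ hθ h₀ hh₀).measurable_f
      (hPLR θ hθ h₀ hh₀).measurable_g).aemeasurable
  -- Degeneracy and the root-`n` rate are exploited at `θ₁`; from `θ₀` only identifiability is
  -- taken.
  obtain ⟨S₁, hHat₁, θHat₁, hfirst₁, hsplit₁, H₁, hgrad₁, hroot₁⟩ := hm θ₁ hθ₁ h₀ hh₀
  obtain ⟨S₀, hHat₀, θHat₀, -, -, H₀, -, -⟩ := hm θ₀ hθ₀ h₀ hh₀
  have hx : Measurable fun z : Data p => z.2.2 := by fun_prop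
  have hmc := H₁.smoothness.contDiff.continuous
  have hzero : ∀ᵐ x ∂P.fst, ∀ t y, m (t, y, x) θ₁ (h₀ x) = 0 := by
    have hf := (hPLR θ₁ hθ₁ h₀ hh₀).measurable_f
    have hg := (hPLR θ₁ hθ₁ h₀ hh₀).measurable_g
    have := hprob θ₁ hθ₁
    have hae := moment_ae_eq_zero hΘ_seg h𝓗_meas
      (by rwa [map_plrLaw_covariate P θ₁ hf hg]) hθ₁ hh₀ hfirst₁ hsplit₁ H₁ hgrad₁ hroot₁
    exact ae_forall_of_ae_plrLaw hsupport hf hg (F := fun z => m z θ₁ (h₀ z.2.2))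
      (fun x => hmc.comp (f := fun q : ℝ × ℝ => ((q.1, q.2, x), θ₁, h₀ x)) (by fun_prop)) hae
  refine H₀.identifiability θ₁ hθ₁ hne.symm (integral_eq_zero_of_ae ?_)
  -- The vanishing holds for all `t, y`, so it transfers to the other model through the common law
  -- of `X` alone.
  rw [← map_plrLaw_covariate P θ₀ (hPLR θ₀ hθ₀ h₀ hh₀).measurable_f
    (hPLR θ₀ hθ₀ h₀ hh₀).measurable_g] at hzero
  filter_upwards [ae_of_ae_map hx.aemeasurable hzero] with z hz
  exact hz z.1 z.2.1
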